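/- Let $N\ge 1$ and let $X_1,\dots,X_N$ be independent random variables, uniformly distributed on $[0,1]$, with order statistics $X_{(1)}\le\dots\le X_{(N)}$. Put $X_{(0)}=0$ and $X_{(N+1)}=1$ (boundaries included), let $G_i=X_{(i)}-X_{(i-1)}$ for $1\le i\le N+1$ be the spacings, and let $G_{(1)}\le\dots\le G_{(N+1)}$ be the spacings in increasing order. For $0\le k\le N+1$ let $$s_k=\sum_{i=1}^{k}G_{(i)},\qquad S_k=\sum_{i=1}^{k}G_{(N+2-i)}$$ be the sums of the $k$ smallest and of the $k$ largest spacings. Let $H(x,a,b)=1$ if $a\le x\le b$ and $H(x,a,b)=0$ otherwise, and put $$A(k,N)=\frac{N\,(N+1)!}{(N+1-k)^{k-1}(N+1-k)!},\qquad a(i,k)=\frac{(-1)^{i-1}(k+1-i)^{k-2}}{(k-i)!\,(i-1)!}\qquad(1\le i\le k\le N),$$ with the convention $0^0=1$. Then $S_k=1-s_{N+1-k}$ for all $0\le k\le N+1$. Moreover, for every $1\le k\le N$, the following holds. (1) With $m=N+1-k$, the random variable $s_m$ has the density $$f_{m}(s)=A(m,N)\sum_{i=1}^{m}a(i,m)\left[1-\frac{N+2-i}{m+1-i}\,s\right]^{N-1}H\!\left(s,0,\frac{m+1-i}{N+2-i}\right),\qquad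 s\in\mathbb R,$$ and $S_k$ has the density $s\mapsto f_{N+1-k}(1-s)$, which equals $$A(N+1-k,N)\sum_{i=1}^{N+1-k}a(i,N+1-k)\left[\frac{s(N+2-i)-k}{N+2-k-i}\right]^{N-1}H\!\left(s,\frac{k}{N+2-i},1\right),\qquad s\in\mathbb R.$$ Both functions are nonnegative everywhere. (2) For every real $s\le 1$, $$\mathbb P(S_k\le s)=\frac{A(N+1-k,N)}{N}\sum_{i=1}^{N+1-k}\frac{a(i,N+1-k)\,(N+2-k-i)}{N+2-i}\left[\frac{s(N+2-i)-k}{N+2-k-i}\right]^{N}H\!\left(s,\frac{k}{N+2-i},1\right),$$ and the tail probability $\mathbb P(S_k\ge s)$ is $1$ minus the right-hand side. -/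

import Mathlib

open MeasureTheory ProbabilityTheory
open scoped Nat

noncomputable section

namespace OrderedSpacings

/-- Order statistics: `sorted x j` is the `(j+1)`-st smallest of the values of `x`. -/
def sorted {n : ℕ} (x : Fin n → ℝ) : Fin n → ℝ := x ∘ Tuple.sort x

/-- The extended ordered sample `X_(0) = 0, X_(1), …, X_(N), X_(N+1) = 1`. -/
def extended {N : ℕ} (x : Fin N → ℝ) : Fin (N + 2) → ℝ :=
  Fin.cons (α := fun _ => ℝ) 0 (Fin.snoc (α := fun _ => ℝ) (sorted x) 1)

/-- The spacings with boundaries included: `spacing x j` is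
`G_{j+1} = X_(j+1) - X_(j)`, for `j = 0, …, N`. -/
def spacing {N : ℕ} (x : Fin N → ℝ) : Fin (N + 1) → ℝ :=
  fun j => extended x j.succ - extended x j.castSucc

/-- The sum `s_k = G_(1) + … + G_(k)` of the `k` smallest spacings. -/
def minSum {N : ℕ} (k : ℕ) (x : Fin N → ℝ) : ℝ :=
  ∑ j : Fin (N + 1) with j.val < k, sorted (spacing x) j

/-- The sum `S_k = G_(N+1) + G_(N) + … + G_(N+2-k)` of the `k` largest spacings;
`Fin.rev` lists the ordered spacings from the largest one downwards. -/
def maxSum {N : ℕ} (k : ℕ) (x : Fin N → ℝ) : ℝ :=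
  ∑ j : Fin (N + 1) with j.val < k, sorted (spacing x) j.rev

/-- `H x a b` is `1` if `a ≤ x ≤ b` and `0` otherwise. -/
def H (x a b : ℝ) : ℝ := Set.indicator (Set.Icc a b) 1 x

/-- `A(k, N) = N (N+1)! / ((N+1-k)^(k-1) (N+1-k)!)`, used for `1 ≤ k ≤ N`. -/
def coeffA (k N : ℕ) : ℝ :=
  (N * (N + 1)! : ℝ) / (((N : ℝ) + 1 - k) ^ (k - 1) * (N + 1 - k)!)

/-- `a(i, k) = (-1)^(i-1) (k+1-i)^(k-2) / ((k-i)! (i-1)!)`, used for `1 ≤ i ≤ k`;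
the exponent `k - 2` is an integer, equal to `-1` when `k = 1`. -/
def coeffa (i k : ℕ) : ℝ :=
  ((-1 : ℝ) ^ (i - 1) * ((k : ℝ) + 1 - i) ^ ((k : ℤ) - 2)) / ((k - i)! * (i - 1)!)

/-- The density formula for `s_k`. -/
def minSumPdf (k N : ℕ) (s : ℝ) : ℝ :=
  coeffA k N * ∑ i ∈ Finset.Icc 1 k,
    coeffa i k * (1 - ((N : ℝ) + 2 - i) / ((k : ℝ) + 1 - i) * s) ^ (N - 1) *
      H s 0 (((k : ℝ) + 1 - i) / ((N : ℝ) + 2 - i))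

/-- The density formula for `S_k`. -/
def maxSumPdf (k N : ℕ) (s : ℝ) : ℝ :=
  coeffA (N + 1 - k) N * ∑ i ∈ Finset.Icc 1 (N + 1 - k),
    coeffa i (N + 1 - k) *
      ((s * ((N : ℝ) + 2 - i) - k) / ((N : ℝ) + 2 - k - i)) ^ (N - 1) *
      H s (k / ((N : ℝ) + 2 - i)) 1

/-- The distribution function formula for `S_k`, for arguments `s ≤ 1`. -/
def maxSumCdf (k N : ℕ) (s : ℝ) : ℝ :=
  coeffA (N + 1 - k) N / N * ∑ i ∈ Finset.Icc 1 (N + 1 - k),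
    coeffa i (N + 1 - k) * ((N : ℝ) + 2 - k - i) / ((N : ℝ) + 2 - i) *
      ((s * ((N : ℝ) + 2 - i) - k) / ((N : ℝ) + 2 - k - i)) ^ N *
      H s (k / ((N : ℝ) + 2 - i)) 1

/-- The real random variable `Y` has the (nonnegative) density `f` with respect to
Lebesgue measure. -/
def HasDensity {Ω : Type*} [MeasurableSpace Ω] (P : Measure Ω) (Y : Ω → ℝ) (f : ℝ → ℝ) : Prop :=
  AEMeasurable Y P ∧ Measurable f ∧ (∀ s, 0 ≤ f s) ∧
    P.map Y = (volume : Measure ℝ).withDensity (fun s => ENNReal.ofReal (f s))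

end OrderedSpacings

end

open scoped Pointwise

namespace OrderedSpacings

/-! Write m for the number of small spacings, so that the m smallest and the N+1-m largest add up to
1. Everything then follows from the tail of `minSum m`.

Because the spacings have total 1, the event t < s_m says that a homogeneous linear form in the
ordered spacings, with weights 1 - t on the m smallest and -t on the others, is positive. Such an
event is a cone, and on cones uniform spacings and N+1 independent standard exponentials have the
same law (`volume_spacing_mem`). By Rényi's representation (`expPi_sorted`), ordered exponentials
have independent increments which become standard exponential after scaling. The event turns into ∑
(r_i - t) z_i > 0 with z_i independent exponentials and r_i = (m-i)/(N+1-i) for i < m, r_i = 0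
afterwards.

For a linear form with coefficients b_i whose positive ones are distinct, partial fractions give the
probability of being positive as the sum over b_i > 0 of ∏_{j≠i} b_i/(b_i - b_j)
(`expPi_real_lt_sum`). With b_i = r_i - t the differences do not involve t, so each term is a
constant times (r_i - t)^N on t < r_i. `coeffA_mul_coeffa` evaluates the constants.

Differentiating this tail yields the density. Its nonnegativity comes from monotonicity of the tail
(`eq_withDensity_of_tail`), as the signs in the formula alternate. -/

/-! ### Permutation symmetry and the ordered chamber. -/

/-- The set is the kernel of a nonzero linear form, a proper subspace, hence null. -/
theorem volume_setOf_eq_coord {n : ℕ} {i j : Fin n} (hij : i ≠ j) :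
    volume {x : Fin n → ℝ | x i = x j} = 0 := by
  let f : (Fin n → ℝ) →ₗ[ℝ] ℝ :=
    (LinearMap.proj i : (Fin n → ℝ) →ₗ[ℝ] ℝ) - (LinearMap.proj j : (Fin n → ℝ) →ₗ[ℝ] ℝ)
  have hf : ∀ x, f x = x i - x j := fun _ => rfl
  have h := Measure.addHaar_submodule (volume : Measure (Fin n → ℝ)) (LinearMap.ker f) (by
    intro h
    have h1 : (Pi.single i 1 : Fin n → ℝ) ∈ LinearMap.ker f := by rw [h]; trivial
    simp [LinearMap.mem_ker, hf, hij.symm] at h1)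
  convert h using 2
  ext x
  simp [LinearMap.mem_ker, hf, sub_eq_zero]

theorem ae_injective {n : ℕ} : ∀ᵐ x : Fin n → ℝ, Function.Injective x := by
  have h : ∀ᵐ x : Fin n → ℝ, ∀ i j, i ≠ j → x i ≠ x j := by
    rw [ae_all_iff]; intro i
    rw [ae_all_iff]; intro j
    by_cases hij : i = j
    · simp [hij]
    · have := volume_setOf_eq_coord hij
      rw [ae_iff]
      simpa [hij] using this
  filter_upwards [h] with x hx i j hij
  by_contra hne
  exact hx i j hne hij

theorem coe_piCongrLeft_symm {n : ℕ} (σ : Equiv.Perm (Fin n)) :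
    ⇑(MeasurableEquiv.piCongrLeft (fun _ : Fin n => ℝ) σ.symm) = fun x => x ∘ σ := by
  ext x i
  have := MeasurableEquiv.piCongrLeft_apply_apply (β := fun _ : Fin n => ℝ) σ.symm x (σ i)
  simpa using this

theorem measurePreserving_comp_perm {n : ℕ} (σ : Equiv.Perm (Fin n)) :
    MeasurePreserving (fun x : Fin n → ℝ => x ∘ σ) := by
  have h := volume_measurePreserving_piCongrLeft (fun _ : Fin n => ℝ) σ.symm
  rwa [coe_piCongrLeft_symm] at h

theorem measurableEmbedding_comp_perm {n : ℕ} (σ : Equiv.Perm (Fin n)) :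
    MeasurableEmbedding (fun x : Fin n → ℝ => x ∘ σ) := by
  have h := (MeasurableEquiv.piCongrLeft (fun _ : Fin n => ℝ) σ.symm).measurableEmbedding
  rwa [coe_piCongrLeft_symm] at h

theorem measurableSet_strictMono {n : ℕ} : MeasurableSet {x : Fin n → ℝ | StrictMono x} := by
  have : {x : Fin n → ℝ | StrictMono x} = ⋂ i, ⋂ j, {x | i < j → x i < x j} := by
    ext x; simp [StrictMono]
  rw [this]
  refine MeasurableSet.iInter fun i => MeasurableSet.iInter fun j => ?_
  by_cases h : i < j
  · simpa [h] using measurableSet_lt (measurable_pi_apply i) (measurable_pi_apply j)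
  · simp [h]

/-- A symmetric function integrates to `n!` times its integral over the ordered chamber. -/
theorem lintegral_eq_factorial_mul_of_symmetric {n : ℕ} (F : (Fin n → ℝ) → ENNReal)
    (hF : ∀ (σ : Equiv.Perm (Fin n)) x, F (x ∘ σ) = F x) :
    ∫⁻ x, F x = n ! * ∫⁻ x in {x | StrictMono x}, F x := by
  set A : Equiv.Perm (Fin n) → Set (Fin n → ℝ) := fun σ => (fun x => x ∘ σ) ⁻¹' {x | StrictMono x}
  have hA : ∀ σ, MeasurableSet (A σ) := fun σ =>
    (measurePreserving_comp_perm σ).measurable measurableSet_strictMono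
  -- Two sorted rearrangements of x coincide, and x is injective on a chamber, so the sorting
  -- permutation is determined.
  have hd : Pairwise (Function.onFun Disjoint A) := by
    intro σ τ hστ
    refine Set.disjoint_left.2 fun x hx hy => hστ ?_
    have hx' : StrictMono (x ∘ σ) := hx
    have hy' : StrictMono (x ∘ τ) := hy
    have h := Tuple.unique_monotone hx'.monotone hy'.monotone
    have hinj : Function.Injective x := by
      have := hx'.injective
      rwa [Function.Injective.of_comp_iff' _ σ.bijective] at this
    ext i
    have := congrFun h i
    exact congrArg _ (hinj this)
  have hae : ∀ᵐ x : Fin n → ℝ, x ∈ ⋃ σ, A σ := by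
    filter_upwards [ae_injective] with x hx
    refine Set.mem_iUnion.2 ⟨Tuple.sort x, ?_⟩
    exact (Tuple.monotone_sort x).strictMono_of_injective (hx.comp (Equiv.injective _))
  rw [← setLIntegral_univ, ← setLIntegral_congr (s := ⋃ σ, A σ) (Filter.eventuallyEq_univ.2 hae),
    lintegral_iUnion hA hd, tsum_fintype]
  have : ∀ σ, ∫⁻ x in A σ, F x = ∫⁻ x in {x | StrictMono x}, F x := by
    intro σ
    rw [← (measurePreserving_comp_perm σ).setLIntegral_comp_preimage_emb
      (measurableEmbedding_comp_perm σ) F {x | StrictMono x}]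
    simp only [hF]; rfl
  simp [this, Fintype.card_perm]

/-! ### Order statistics. -/

/-- The sorting permutation takes finitely many values; on the closed chamber of σ the statistic is
the coordinate σ j. Overlaps are harmless because sorted rearrangements are unique. -/
theorem measurable_sorted {n : ℕ} (j : Fin n) : Measurable fun x : Fin n → ℝ => sorted x j := by
  refine measurable_of_Iic fun a => ?_
  have hs : ∀ σ : Equiv.Perm (Fin n), MeasurableSet {x : Fin n → ℝ | Monotone (x ∘ σ)} := by
    intro σ
    have : {x : Fin n → ℝ | Monotone (x ∘ σ)} = ⋂ i, ⋂ j, {x | i ≤ j → x (σ i) ≤ x (σ j)} := by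
      ext x; simp [Monotone]
    rw [this]
    refine MeasurableSet.iInter fun i => MeasurableSet.iInter fun j => ?_
    by_cases h : i ≤ j
    · simpa [h] using measurableSet_le (measurable_pi_apply (σ i)) (measurable_pi_apply (σ j))
    · simp [h]
  have : (fun x : Fin n → ℝ => sorted x j) ⁻¹' Set.Iic a =
      ⋃ σ : Equiv.Perm (Fin n), {x | Monotone (x ∘ σ)} ∩ {x | x (σ j) ≤ a} := by
    ext x
    simp only [Set.mem_preimage, Set.mem_Iic, Set.mem_iUnion, Set.mem_inter_iff, Set.mem_ofPred_eq]
    constructor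
    · intro h; exact ⟨_, Tuple.monotone_sort x, h⟩
    · rintro ⟨σ, hσ, h⟩
      have := Tuple.unique_monotone (Tuple.monotone_sort x) hσ
      have := congrFun this j
      simp only [Function.comp_apply] at this
      rwa [sorted, Function.comp_apply, this]
  rw [this]
  exact MeasurableSet.iUnion fun σ => (hs σ).inter
    (measurableSet_le (measurable_pi_apply _) measurable_const)

theorem sorted_of_monotone {n : ℕ} {x : Fin n → ℝ} (h : Monotone x) : sorted x = x := by
  rw [sorted, Tuple.sort_eq_refl_iff_monotone.2 h]; rfl

theorem sorted_comp_perm {n : ℕ} (x : Fin n → ℝ) (σ : Equiv.Perm (Fin n)) :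
    sorted (x ∘ σ) = sorted x := Tuple.comp_perm_comp_sort_eq_comp_sort

theorem sorted_smul {n : ℕ} {t : ℝ} (ht : 0 < t) (x : Fin n → ℝ) :
    sorted (t • x) = t • sorted x := by
  have h : Monotone ((t • x) ∘ Tuple.sort x) := fun i j hij =>
    mul_le_mul_of_nonneg_left (Tuple.monotone_sort x hij) ht.le
  exact Tuple.unique_monotone (Tuple.monotone_sort _) h

theorem sum_sorted {n : ℕ} (x : Fin n → ℝ) : ∑ j, sorted x j = ∑ j, x j :=
  Equiv.sum_comp (Tuple.sort x) x

/-! ### Partial sums and increments. -/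

/-- Partial sums of a vector. -/
def cumsum {n : ℕ} (u : Fin n → ℝ) : Fin n → ℝ := fun j => ∑ i ∈ Finset.Iic j, u i

/-- Successive differences of a vector, the first one being taken from `0`. -/
def diff {n : ℕ} (y : Fin n → ℝ) : Fin n → ℝ := fun j =>
  (Fin.cons 0 y : Fin (n + 1) → ℝ) j.succ - (Fin.cons 0 y : Fin (n + 1) → ℝ) j.castSucc

theorem diff_zero {n : ℕ} (y : Fin (n + 1) → ℝ) : diff y 0 = y 0 := by
  simp [diff]

theorem diff_succ {n : ℕ} (y : Fin (n + 1) → ℝ) (i : Fin n) :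
    diff y i.succ = y i.succ - y i.castSucc := by
  simp [diff]

theorem spacing_eq_diff {N : ℕ} (x : Fin N → ℝ) :
    spacing x = diff (Fin.snoc (α := fun _ => ℝ) (sorted x) 1) := rfl

theorem cumsum_zero {n : ℕ} (u : Fin (n + 1) → ℝ) : cumsum u 0 = u 0 := by
  have : Finset.Iic (0 : Fin (n + 1)) = {0} := by ext i; simp
  simp [cumsum, this]

theorem cumsum_succ {n : ℕ} (u : Fin (n + 1) → ℝ) (i : Fin n) :
    cumsum u i.succ = cumsum u i.castSucc + u i.succ := by
  have : Finset.Iic i.succ = insert i.succ (Finset.Iic i.castSucc) := by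
    ext j; simp [Fin.le_def, Fin.ext_iff]; omega
  rw [cumsum, this, Finset.sum_insert (by simp), cumsum, add_comm]

theorem diff_cumsum {n : ℕ} (u : Fin (n + 1) → ℝ) : diff (cumsum u) = u := by
  ext j
  refine Fin.cases ?_ (fun i => ?_) j
  · rw [diff_zero, cumsum_zero]
  · rw [diff_succ, cumsum_succ]; ring

theorem strictMono_cumsum_iff {n : ℕ} (u : Fin (n + 1) → ℝ) :
    (StrictMono (cumsum u) ∧ 0 < cumsum u 0) ↔ ∀ i, 0 < u i := by
  rw [Fin.strictMono_iff_lt_succ, cumsum_zero, Fin.forall_fin_succ, and_comm]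
  simp [cumsum_succ]

theorem toLin'_cumsum {n : ℕ} :
    ⇑(Matrix.toLin' (Matrix.of fun i j : Fin n => if j ≤ i then (1 : ℝ) else 0)) = cumsum := by
  ext u j
  simp [cumsum, Matrix.mulVec, dotProduct, Finset.sum_ite, Finset.filter_ge_eq_Iic]

/-- The matrix is lower triangular with unit diagonal, so its determinant is 1. -/
theorem measurePreserving_cumsum {n : ℕ} :
    MeasurePreserving (cumsum : (Fin n → ℝ) → Fin n → ℝ) := by
  have hdet : (Matrix.of fun i j : Fin n => if j ≤ i then (1 : ℝ) else 0).det = 1 := by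
    rw [Matrix.det_of_isLowerTriangular]
    · simp
    · intro i j hij
      simp only [OrderDual.toDual_lt_toDual] at hij
      simp [not_le.2 hij]
  have h := Real.map_matrix_volume_pi_eq_smul_volume_pi (hdet.trans_ne one_ne_zero)
  rw [hdet, toLin'_cumsum] at h
  refine ⟨?_, by simpa using h⟩
  rw [← toLin'_cumsum]
  exact (LinearMap.continuous_of_finiteDimensional _).measurable

theorem measurableEmbedding_cumsum {n : ℕ} :
    MeasurableEmbedding (cumsum : (Fin (n + 1) → ℝ) → Fin (n + 1) → ℝ) := by
  refine Continuous.measurableEmbedding ?_ ?_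
  · rw [← toLin'_cumsum]; exact LinearMap.continuous_of_finiteDimensional _
  · exact Function.LeftInverse.injective diff_cumsum

/-- Change of variables from a positive increasing vector to its increments. -/
theorem setLIntegral_strictMono_pos {n : ℕ} (F : (Fin (n + 1) → ℝ) → ENNReal) :
    ∫⁻ y in {y | StrictMono y ∧ 0 < y 0}, F y = ∫⁻ u in {u | ∀ i, 0 < u i}, F (cumsum u) := by
  rw [← measurePreserving_cumsum.setLIntegral_comp_preimage_emb measurableEmbedding_cumsum]
  congr 2
  ext u
  exact strictMono_cumsum_iff u

theorem lintegral_fin_snoc {n : ℕ} {F : (Fin (n + 1) → ℝ) → ENNReal} (hF : Measurable F) :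
    ∫⁻ z, F z = ∫⁻ t : ℝ, ∫⁻ w : Fin n → ℝ, F (Fin.snoc (α := fun _ => ℝ) w t) := by
  have h := (volume_preserving_piFinSuccAbove (fun _ : Fin (n + 1) => ℝ) (Fin.last n)).symm
  rw [← h.lintegral_comp hF, Measure.volume_eq_prod, lintegral_prod]
  · refine lintegral_congr fun t => lintegral_congr fun w => ?_
    congr 1
    simp [MeasurableEquiv.piFinSuccAbove]
    rfl
  · exact (hF.comp (MeasurableEquiv.measurable _)).aemeasurable

/-! ### Independent exponentials and Rényi's representation. -/

/-- The standard exponential density, as an extended nonnegative function. -/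
noncomputable def expWeight : ℝ → ENNReal :=
  (Set.Ioi 0).indicator fun t => ENNReal.ofReal (Real.exp (-t))

theorem measurable_expWeight : Measurable expWeight :=
  Measurable.indicator (by fun_prop) measurableSet_Ioi

theorem expWeight_of_pos {t : ℝ} (ht : 0 < t) : expWeight t = ENNReal.ofReal (Real.exp (-t)) :=
  Set.indicator_of_mem ht _

theorem expWeight_of_nonpos {t : ℝ} (ht : t ≤ 0) : expWeight t = 0 :=
  Set.indicator_of_notMem (by simpa using ht) _

theorem measurable_prod_expWeight {n : ℕ} :
    Measurable fun z : Fin n → ℝ => ∏ i, expWeight (z i) :=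
  Finset.measurable_prod _ fun i _ => measurable_expWeight.comp (measurable_pi_apply i)

theorem prod_expWeight_of_pos {n : ℕ} {z : Fin n → ℝ} (hz : ∀ i, 0 < z i) :
    ∏ i, expWeight (z i) = ENNReal.ofReal (Real.exp (-∑ i, z i)) := by
  rw [← Finset.sum_neg_distrib, Real.exp_sum,
    ENNReal.ofReal_prod_of_nonneg fun _ _ => (Real.exp_pos _).le]
  exact Finset.prod_congr rfl fun i _ => expWeight_of_pos (hz i)

theorem prod_expWeight_of_not_pos {n : ℕ} {z : Fin n → ℝ} (hz : ¬ ∀ i, 0 < z i) :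
    ∏ i, expWeight (z i) = 0 := by
  push Not at hz
  obtain ⟨i, hi⟩ := hz
  exact Finset.prod_eq_zero (Finset.mem_univ i) (expWeight_of_nonpos hi)

/-- The law of `n` independent standard exponential variables. -/
noncomputable def expPi (n : ℕ) : Measure (Fin n → ℝ) :=
  volume.withDensity fun z => ∏ i, expWeight (z i)

theorem expPi_apply {n : ℕ} {S : Set (Fin n → ℝ)} (hS : MeasurableSet S) :
    expPi n S = ∫⁻ z, S.indicator (fun z => ∏ i, expWeight (z i)) z := by
  rw [expPi, withDensity_apply _ hS, lintegral_indicator hS]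

theorem sum_cumsum_mul {n : ℕ} (w u : Fin n → ℝ) :
    ∑ j, w j * cumsum u j = ∑ i, (∑ j ∈ Finset.Ici i, w j) * u i := by
  simp only [cumsum, Finset.mul_sum, Finset.sum_mul]
  exact Finset.sum_comm' (by simp)

theorem lintegral_comp_mul_pi {n : ℕ} {d : Fin n → ℝ} (hd : ∀ i, 0 < d i)
    {F : (Fin n → ℝ) → ENNReal} (hF : Measurable F) :
    ENNReal.ofReal (∏ i, d i) * ∫⁻ u : Fin n → ℝ, F (fun i => d i * u i) = ∫⁻ z, F z := by
  have hdet : (Matrix.diagonal d).det = ∏ i, d i := Matrix.det_diagonal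
  have hpos : 0 < ∏ i, d i := Finset.prod_pos fun i _ => hd i
  have h := Real.smul_map_diagonal_volume_pi (D := d) (by rw [hdet]; exact hpos.ne')
  have hm : Measurable (Matrix.toLin' (Matrix.diagonal d)) :=
    (LinearMap.continuous_of_finiteDimensional _).measurable
  conv_rhs => rw [← h]
  rw [lintegral_smul_measure, lintegral_map hF hm, hdet, abs_of_pos hpos, smul_eq_mul]
  congr 1
  refine lintegral_congr fun u => congrArg F ?_
  ext i
  simp [Matrix.mulVec_diagonal]

/-- This is the Jacobian of the rescaling in Rényi's representation; it cancels the number of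
orderings. -/
theorem prod_fin_sub {n : ℕ} : ∏ i : Fin n, ((n : ℝ) - i) = n ! := by
  induction n with
  | zero => simp
  | succ n ih =>
    rw [Fin.prod_univ_succ, Nat.factorial_succ]
    simp [← ih]

theorem card_Ici_fin {n : ℕ} (i : Fin n) : (∑ _j ∈ Finset.Ici i, (1 : ℝ)) = n - i := by
  rw [Finset.sum_const, Fin.card_Ici, nsmul_eq_mul, mul_one, Nat.cast_sub i.2.le]

/-- The ordered exponentials, normalised to have independent exponential increments. -/
theorem expPi_sorted {n : ℕ} (w : Fin (n + 1) → ℝ) :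
    expPi (n + 1) {y | 0 < ∑ j, w j * sorted y j} =
      expPi (n + 1) {z | 0 < ∑ i, (∑ j ∈ Finset.Ici i, w j) / (((n + 1 : ℕ) : ℝ) - i) * z i} := by
  have hm1 : MeasurableSet {y : Fin (n + 1) → ℝ | 0 < ∑ j, w j * sorted y j} :=
    measurableSet_lt measurable_const
      (Finset.measurable_sum _ fun j _ => (measurable_sorted j).const_mul _)
  have hm2 : MeasurableSet {z : Fin (n + 1) → ℝ |
      0 < ∑ i, (∑ j ∈ Finset.Ici i, w j) / (((n + 1 : ℕ) : ℝ) - i) * z i} :=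
    measurableSet_lt measurable_const
      (Finset.measurable_sum _ fun j _ => (measurable_pi_apply j).const_mul _)
  have hd : ∀ i : Fin (n + 1), 0 < ((n + 1 : ℕ) : ℝ) - i := fun i =>
    sub_pos.2 (by exact_mod_cast i.2)
  have hC : MeasurableSet {y : Fin (n + 1) → ℝ | StrictMono y ∧ 0 < y 0} :=
    measurableSet_strictMono.inter (measurableSet_lt measurable_const (measurable_pi_apply 0))
  have hO : MeasurableSet {u : Fin (n + 1) → ℝ | ∀ i, 0 < u i} := by
    rw [Set.ofPred_forall]
    exact MeasurableSet.iInter fun i => measurableSet_lt measurable_const (measurable_pi_apply i)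
  -- The factor (n+1)! arises on the left from symmetrisation and on the right as the Jacobian of
  -- z_i = (n+1-i) u_i. Only the integrals over ordered positive y = `cumsum u` remain to be
  -- compared.
  rw [expPi_apply hm1, expPi_apply hm2, lintegral_eq_factorial_mul_of_symmetric,
    ← lintegral_comp_mul_pi hd (measurable_prod_expWeight.indicator hm2), prod_fin_sub,
    ENNReal.ofReal_natCast]
  · congr 1
    trans ∫⁻ y in {y : Fin (n + 1) → ℝ | StrictMono y ∧ 0 < y 0},
      {y | 0 < ∑ j, w j * y j}.indicator (fun z => ∏ i, expWeight (z i)) y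
    · rw [← lintegral_indicator measurableSet_strictMono, ← lintegral_indicator hC]
      refine lintegral_congr fun y => ?_
      by_cases hy : StrictMono y
      · by_cases h0 : 0 < y 0
        · simp [Set.indicator, hy, h0, sorted_of_monotone hy.monotone]
        · have : ∏ i, expWeight (y i) = 0 := prod_expWeight_of_not_pos fun h => h0 (h 0)
          simp [Set.indicator, hy, h0, this]
      · simp [Set.indicator, hy]
    · rw [setLIntegral_strictMono_pos, ← lintegral_indicator hO]
      refine lintegral_congr fun u => ?_
      have hs : ∑ i, (∑ j ∈ Finset.Ici i, w j) / (((n + 1 : ℕ) : ℝ) - i) *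
          ((((n + 1 : ℕ) : ℝ) - i) * u i) = ∑ j, w j * cumsum u j := by
        rw [sum_cumsum_mul]
        refine Finset.sum_congr rfl fun i _ => ?_
        rw [← mul_assoc, div_mul_cancel₀ _ (hd i).ne']
      -- The total of the scaled increments is the total of the ordered values, so the two
      -- exponential densities agree.
      have hs' : ∑ i, (((n + 1 : ℕ) : ℝ) - i) * u i = ∑ j, cumsum u j := by
        have := sum_cumsum_mul (fun _ => 1) u
        simp only [card_Ici_fin, one_mul] at this
        exact this.symm
      by_cases hu : ∀ i, 0 < u i
      · have h1 := (strictMono_cumsum_iff u).2 hu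
        have h2 : ∀ j, 0 < cumsum u j := fun j => h1.2.trans_le (h1.1.monotone (Fin.zero_le j))
        simp only [Set.indicator, Set.mem_ofPred_eq, hs, hu, implies_true, if_true]
        rw [prod_expWeight_of_pos h2, prod_expWeight_of_pos fun i => mul_pos (hd i) (hu i), hs']
      · have h1 : ¬ ∀ i : Fin (n + 1), 0 < (((n + 1 : ℕ) : ℝ) - i) * u i := by
          simpa only [mul_pos_iff_of_pos_left (hd _)] using hu
        simp only [Set.indicator, Set.mem_ofPred_eq, hu, if_false]
        rw [prod_expWeight_of_not_pos h1]
        simp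
  · intro σ y
    simp only [Set.indicator, Set.mem_ofPred_eq, sorted_comp_perm, Function.comp_apply]
    rw [Equiv.prod_comp σ fun i => expWeight (y i)]

/-! ### Uniform spacings as normalised exponentials. -/

theorem diff_smul {n : ℕ} (t : ℝ) (y : Fin n → ℝ) : diff (t • y) = t • diff y := by
  cases n with
  | zero => exact Subsingleton.elim _ _
  | succ n =>
    ext j
    refine Fin.cases ?_ (fun i => ?_) j
    · simp [diff_zero]
    · simp [diff_succ, mul_sub]

theorem snoc_smul {n : ℕ} (t : ℝ) (x : Fin n → ℝ) (s : ℝ) :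
    (Fin.snoc (α := fun _ => ℝ) (t • x) (t * s) : Fin (n + 1) → ℝ) =
      t • Fin.snoc (α := fun _ => ℝ) x s := by
  ext j
  refine Fin.lastCases ?_ (fun i => ?_) j <;> simp

theorem measurable_snoc {n : ℕ} (t : ℝ) :
    Measurable fun x : Fin n → ℝ => (Fin.snoc (α := fun _ => ℝ) x t : Fin (n + 1) → ℝ) := by
  refine measurable_pi_iff.2 fun j => ?_
  refine Fin.lastCases ?_ (fun i => ?_) j
  · simp
  · simpa using measurable_pi_apply i

theorem measurable_diff {n : ℕ} : Measurable (diff : (Fin n → ℝ) → Fin n → ℝ) := by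
  cases n with
  | zero => exact measurable_pi_iff.2 fun j => j.elim0
  | succ n =>
    refine measurable_pi_iff.2 fun j => ?_
    refine Fin.cases ?_ (fun i => ?_) j
    · simpa [diff_zero] using measurable_pi_apply 0
    · simp only [diff_succ]; fun_prop

theorem measurable_spacing {n : ℕ} : Measurable (spacing : (Fin n → ℝ) → Fin (n + 1) → ℝ) := by
  have h : Measurable (sorted : (Fin n → ℝ) → Fin n → ℝ) := measurable_pi_iff.2 measurable_sorted
  exact measurable_diff.comp ((measurable_snoc 1).comp h)

theorem strictMono_snoc_iff {n : ℕ} (x : Fin n → ℝ) :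
    (StrictMono (Fin.snoc (α := fun _ => ℝ) x 1 : Fin (n + 1) → ℝ) ∧
      0 < (Fin.snoc (α := fun _ => ℝ) x 1 : Fin (n + 1) → ℝ) 0) ↔
    StrictMono x ∧ ∀ i, 0 < x i ∧ x i < 1 := by
  constructor
  · rintro ⟨h1, h0⟩
    refine ⟨fun i j hij => ?_, fun i => ⟨?_, ?_⟩⟩
    · simpa using h1 (Fin.castSucc_lt_castSucc_iff.2 hij)
    · simpa using h0.trans_le (h1.monotone (Fin.zero_le i.castSucc))
    · simpa using h1 (Fin.castSucc_lt_last i)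
  · rintro ⟨h1, h0⟩
    have hpos : ∀ j, 0 < (Fin.snoc (α := fun _ => ℝ) x 1 : Fin (n + 1) → ℝ) j := by
      intro j
      refine Fin.lastCases ?_ (fun i => ?_) j
      · simp
      · simpa using (h0 i).1
    refine ⟨fun i j => ?_, hpos 0⟩
    refine Fin.lastCases ?_ (fun i => ?_) i <;> refine Fin.lastCases ?_ (fun j => ?_) j
    · simp
    · intro h; exact absurd (Fin.castSucc_lt_last j) h.not_gt
    · intro _; simpa using (h0 i).2
    · intro h; simpa using h1 (Fin.castSucc_lt_castSucc_iff.1 h)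

theorem lintegral_expWeight_mul_pow (N : ℕ) :
    ∫⁻ t, expWeight t * ENNReal.ofReal (t ^ N) = N ! := by
  have h1 : ∀ t, expWeight t * ENNReal.ofReal (t ^ N) =
      (Set.Ioi 0).indicator (fun t => ENNReal.ofReal (Real.exp (-t) * t ^ N)) t := by
    intro t
    by_cases ht : 0 < t
    · rw [expWeight_of_pos ht, Set.indicator_of_mem (Set.mem_Ioi.2 ht), ENNReal.ofReal_mul (Real.exp_pos _).le]
    · rw [expWeight_of_nonpos (not_lt.1 ht), Set.indicator_of_notMem (by simpa using ht), zero_mul]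
  have hG := Real.GammaIntegral_convergent (s := N + 1) (by positivity)
  have hG' := Real.Gamma_eq_integral (s := N + 1) (by positivity)
  simp only [add_sub_cancel_right, Real.rpow_natCast] at hG hG'
  simp_rw [h1]
  rw [lintegral_indicator measurableSet_Ioi, ← ofReal_integral_eq_lintegral_ofReal hG, ← hG',
    Real.Gamma_nat_eq_factorial, ENNReal.ofReal_natCast]
  filter_upwards [self_mem_ae_restrict measurableSet_Ioi] with t ht
  have : (0 : ℝ) < t := ht
  simp only [Pi.zero_apply]; positivity

/-- The spacings of a uniform sample have the law of normalised exponentials: the two laws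
agree on cones. -/
theorem volume_spacing_mem {N : ℕ} {B : Set (Fin (N + 1) → ℝ)} (hB : MeasurableSet B)
    (hcone : ∀ t : ℝ, 0 < t → ∀ y, t • y ∈ B ↔ y ∈ B) :
    volume {x : Fin N → ℝ | (∀ i, 0 < x i ∧ x i < 1) ∧ spacing x ∈ B} = expPi (N + 1) B := by
  set C : Set (Fin (N + 1) → ℝ) := {y | StrictMono y ∧ 0 < y 0} with hCdef
  have hC : MeasurableSet C :=
    measurableSet_strictMono.inter (measurableSet_lt measurable_const (measurable_pi_apply 0))
  have hO : MeasurableSet {u : Fin (N + 1) → ℝ | ∀ i, 0 < u i} := by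
    rw [Set.ofPred_forall]
    exact MeasurableSet.iInter fun i => measurableSet_lt measurable_const (measurable_pi_apply i)
  have hCB : MeasurableSet (C ∩ diff ⁻¹' B) := hC.inter (measurable_diff hB)
  -- The slice of the cone where the last partial sum is t. By homogeneity it is t times the slice
  -- at 1, which consists of the ordered samples whose spacings lie in B.
  set D : ℝ → Set (Fin N → ℝ) := fun t =>
    {w | (Fin.snoc (α := fun _ => ℝ) w t : Fin (N + 1) → ℝ) ∈ C ∩ diff ⁻¹' B}
  have hDm : ∀ t, MeasurableSet (D t) := fun t => measurable_snoc t hCB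
  have hscale : ∀ t > 0, D t = t • D 1 := by
    intro t ht
    ext w
    rw [Set.mem_smul_set_iff_inv_smul_mem₀ ht.ne']
    have hw : (Fin.snoc (α := fun _ => ℝ) w t : Fin (N + 1) → ℝ) =
        t • Fin.snoc (α := fun _ => ℝ) (t⁻¹ • w) 1 := by
      rw [← snoc_smul, smul_inv_smul₀ ht.ne', mul_one]
    set y : Fin (N + 1) → ℝ := Fin.snoc (α := fun _ => ℝ) (t⁻¹ • w) 1
    change _ ∈ C ∩ diff ⁻¹' B ↔ y ∈ C ∩ diff ⁻¹' B
    rw [hw]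
    simp only [hCdef, Set.mem_inter_iff, Set.mem_preimage, Set.mem_ofPred_eq, diff_smul,
      hcone t ht, StrictMono, Pi.smul_apply, smul_eq_mul, mul_lt_mul_iff_right₀ ht,
      mul_pos_iff_of_pos_left ht]
  have hlhs : volume {x : Fin N → ℝ | (∀ i, 0 < x i ∧ x i < 1) ∧ spacing x ∈ B} =
      N ! * volume (D 1) := by
    have hU : MeasurableSet {x : Fin N → ℝ | (∀ i, 0 < x i ∧ x i < 1) ∧ spacing x ∈ B} := by
      have : {x : Fin N → ℝ | (∀ i, 0 < x i ∧ x i < 1) ∧ spacing x ∈ B} =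
          (⋂ i, {x | 0 < x i} ∩ {x | x i < 1}) ∩ spacing ⁻¹' B := by
        ext x; simp
      rw [this]
      exact (MeasurableSet.iInter fun i =>
        (measurableSet_lt measurable_const (measurable_pi_apply i)).inter
          (measurableSet_lt (measurable_pi_apply i) measurable_const)).inter (measurable_spacing hB)
    rw [← lintegral_indicator_one hU, lintegral_eq_factorial_mul_of_symmetric]
    · congr 1
      rw [lintegral_indicator_one hU, Measure.restrict_apply hU]
      congr 1
      ext x
      have := strictMono_snoc_iff x
      constructor
      · rintro ⟨⟨h1, h2⟩, h3⟩
        have h3' : StrictMono x := h3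
        refine ⟨this.2 ⟨h3, h1⟩, ?_⟩
        rwa [spacing_eq_diff, sorted_of_monotone h3'.monotone] at h2
      · rintro ⟨h1, h2⟩
        have h3 := this.1 h1
        refine ⟨⟨h3.2, ?_⟩, h3.1⟩
        rwa [spacing_eq_diff, sorted_of_monotone h3.1.monotone]
    · intro σ x
      have h1 : spacing (x ∘ σ) = spacing x := by
        rw [spacing_eq_diff, spacing_eq_diff, sorted_comp_perm]
      have h2 : (∀ i, 0 < x (σ i) ∧ x (σ i) < 1) ↔ ∀ i, 0 < x i ∧ x i < 1 :=
        σ.forall_congr_left.trans (by simp)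
      have h3 : x ∘ σ ∈ {x : Fin N → ℝ | (∀ i, 0 < x i ∧ x i < 1) ∧ spacing x ∈ B} ↔
          x ∈ {x : Fin N → ℝ | (∀ i, 0 < x i ∧ x i < 1) ∧ spacing x ∈ B} := by
        rw [Set.mem_ofPred_eq, Set.mem_ofPred_eq, h1]
        exact and_congr_left' h2
      by_cases hx : x ∈ {x : Fin N → ℝ | (∀ i, 0 < x i ∧ x i < 1) ∧ spacing x ∈ B}
      · rw [Set.indicator_of_mem hx, Set.indicator_of_mem (h3.2 hx)]; rfl
      · rw [Set.indicator_of_notMem hx, Set.indicator_of_notMem (mt h3.1 hx)]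
  -- The exponents add up to the last partial sum, so in these coordinates the density depends on
  -- the last coordinate alone. Slicing along it gives ∫ exp(-t) t^N dt = N! times the volume of the
  -- slice at 1, matching `hlhs`.
  have key : expPi (N + 1) B = ∫⁻ y, (C ∩ diff ⁻¹' B).indicator
      (fun y => expWeight (y (Fin.last N))) y := by
    rw [expPi_apply hB, ← Set.indicator_indicator, lintegral_indicator hC,
      setLIntegral_strictMono_pos, ← lintegral_indicator hO]
    refine lintegral_congr fun u => ?_
    by_cases hu : ∀ i, 0 < u i
    · have h1 := (strictMono_cumsum_iff u).2 hu
      have h2 : cumsum u (Fin.last N) = ∑ i, u i := by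
        have : Finset.Iic (Fin.last N) = Finset.univ := by ext i; simp [Fin.le_last]
        rw [cumsum, this]
      have h3 : 0 < cumsum u (Fin.last N) := h1.2.trans_le (h1.1.monotone (Fin.zero_le _))
      simp only [Set.indicator, Set.mem_ofPred_eq, hu, implies_true, if_true]
      have h4 : cumsum u ∈ diff ⁻¹' B ↔ u ∈ B := by rw [Set.mem_preimage, diff_cumsum]
      rw [prod_expWeight_of_pos hu, expWeight_of_pos h3, h2]
      classical exact if_congr h4.symm rfl rfl
    · simp only [Set.indicator, Set.mem_ofPred_eq, hu, if_false]
      rw [prod_expWeight_of_not_pos hu]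
      simp
  have hw : Measurable fun y : Fin (N + 1) → ℝ => expWeight (y (Fin.last N)) :=
    measurable_expWeight.comp (measurable_pi_apply _)
  rw [hlhs, key, lintegral_fin_snoc (hw.indicator hCB)]
  have h4 : ∀ t, ∫⁻ w : Fin N → ℝ, (C ∩ diff ⁻¹' B).indicator
      (fun y => expWeight (y (Fin.last N))) (Fin.snoc (α := fun _ => ℝ) w t) =
      expWeight t * ENNReal.ofReal (t ^ N) * volume (D 1) := by
    intro t
    have : ∀ w : Fin N → ℝ, (C ∩ diff ⁻¹' B).indicator
      (fun y => expWeight (y (Fin.last N))) (Fin.snoc (α := fun _ => ℝ) w t) =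
        (D t).indicator (fun _ => expWeight t) w := by
      intro w
      simp [Set.indicator, D]
    simp_rw [this]
    rw [lintegral_indicator (hDm t), setLIntegral_const]
    by_cases ht : 0 < t
    · rw [hscale t ht, Measure.addHaar_smul, Module.finrank_fin_fun, abs_of_pos (pow_pos ht N),
        mul_assoc]
    · simp [expWeight_of_nonpos (not_lt.1 ht)]
  simp_rw [h4]
  rw [lintegral_mul_const _ (by have := measurable_expWeight; fun_prop), lintegral_expWeight_mul_pow]

/-! ### Tails of linear combinations of exponentials. -/

theorem measurable_fin_snoc {n : ℕ} :
    Measurable fun p : ℝ × (Fin n → ℝ) => (Fin.snoc (α := fun _ => ℝ) p.2 p.1 : Fin (n + 1) → ℝ) := by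
  refine measurable_pi_iff.2 fun j => ?_
  refine Fin.lastCases ?_ (fun i => ?_) j
  · simpa using measurable_fst
  · simp only [Fin.snoc_castSucc]; fun_prop

theorem expPi_succ_apply {n : ℕ} {S : Set (Fin (n + 1) → ℝ)} (hS : MeasurableSet S) :
    expPi (n + 1) S = ∫⁻ e, expWeight e *
      expPi n {w | (Fin.snoc (α := fun _ => ℝ) w e : Fin (n + 1) → ℝ) ∈ S} := by
  rw [expPi_apply hS, lintegral_fin_snoc (measurable_prod_expWeight.indicator hS)]
  refine lintegral_congr fun e => ?_
  have hS' : MeasurableSet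
      {w : Fin n → ℝ | (Fin.snoc (α := fun _ => ℝ) w e : Fin (n + 1) → ℝ) ∈ S} :=
    measurable_snoc e hS
  rw [expPi_apply hS',
    ← lintegral_const_mul _ (measurable_prod_expWeight.indicator hS')]
  refine lintegral_congr fun w => ?_
  by_cases h : (Fin.snoc (α := fun _ => ℝ) w e : Fin (n + 1) → ℝ) ∈ S
  · rw [Set.indicator_of_mem h, Set.indicator_of_mem (by exact h), Fin.prod_univ_castSucc, mul_comm]
    simp
  · rw [Set.indicator_of_notMem h, Set.indicator_of_notMem (by exact h), mul_zero]

instance isProbabilityMeasure_expPi (n : ℕ) : IsProbabilityMeasure (expPi n) := by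
  refine ⟨?_⟩
  induction n with
  | zero => simp [expPi_apply, volume_pi]
  | succ n ih =>
    have := lintegral_expWeight_mul_pow 0
    simp only [pow_zero, ENNReal.ofReal_one, mul_one, Nat.factorial_zero, Nat.cast_one] at this
    simp [expPi_succ_apply, ih, this]

theorem expPi_succ_real {n : ℕ} {S : Set (Fin (n + 1) → ℝ)} (hS : MeasurableSet S) :
    (expPi (n + 1)).real S = ∫ e in Set.Ioi 0, Real.exp (-e) *
      (expPi n).real {w | (Fin.snoc (α := fun _ => ℝ) w e : Fin (n + 1) → ℝ) ∈ S} := by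
  have hm : Measurable fun e : ℝ =>
      expPi n {w | (Fin.snoc (α := fun _ => ℝ) w e : Fin (n + 1) → ℝ) ∈ S} :=
    measurable_measure_prodMk_left (measurable_fin_snoc hS)
  rw [integral_eq_lintegral_of_nonneg_ae, measureReal_def, expPi_succ_apply hS,
    ← lintegral_indicator measurableSet_Ioi]
  · congr 1
    refine lintegral_congr fun e => ?_
    by_cases he : 0 < e
    · rw [expWeight_of_pos he, Set.indicator_of_mem (Set.mem_Ioi.2 he),
        ENNReal.ofReal_mul (Real.exp_pos _).le, ofReal_measureReal]
    · rw [expWeight_of_nonpos (not_lt.1 he), Set.indicator_of_notMem (by simpa using he), zero_mul]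
  · exact Filter.Eventually.of_forall fun e => by
      simp only [Pi.zero_apply]; positivity
  · have : Measurable fun e : ℝ => Real.exp (-e) *
      (expPi n).real {w | (Fin.snoc (α := fun _ => ℝ) w e : Fin (n + 1) → ℝ) ∈ S} :=
      (by fun_prop : Measurable fun e : ℝ => Real.exp (-e)).mul hm.ennreal_toReal
    exact this.aestronglyMeasurable

theorem expPi_ae_pos (n : ℕ) : ∀ᵐ z ∂expPi n, ∀ i, 0 < z i := by
  rw [expPi, ae_withDensity_iff measurable_prod_expWeight]
  exact Filter.Eventually.of_forall fun z hz => by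
    by_contra h
    exact hz (prod_expWeight_of_not_pos h)

theorem measurableSet_lt_sum {n : ℕ} (b : Fin n → ℝ) (t : ℝ) :
    MeasurableSet {z : Fin n → ℝ | t < ∑ i, b i * z i} :=
  measurableSet_lt measurable_const
    (Finset.measurable_sum _ fun j _ => (measurable_pi_apply j).const_mul _)

theorem expPi_real_lt_sum_of_neg {n : ℕ} {b : Fin n → ℝ} (hb : ∀ i, 0 ≤ b i) {t : ℝ} (ht : t < 0) :
    (expPi n).real {z | t < ∑ i, b i * z i} = 1 := by
  have h : expPi n {z | t < ∑ i, b i * z i} = 1 := by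
    rw [← mem_ae_iff_prob_eq_one (measurableSet_lt_sum b t)]
    filter_upwards [expPi_ae_pos n] with z hz
    exact ht.trans_le (Finset.sum_nonneg fun i _ => mul_nonneg (hb i) (hz i).le)
  rw [measureReal_def, h, ENNReal.toReal_one]

theorem expPi_real_zero_lt_sum {n : ℕ} {b : Fin n → ℝ} (hb : ∀ i, 0 ≤ b i) (hex : ∃ i, 0 < b i) :
    (expPi n).real {z | 0 < ∑ i, b i * z i} = 1 := by
  obtain ⟨i, hi⟩ := hex
  have h : expPi n {z | 0 < ∑ i, b i * z i} = 1 := by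
    rw [← mem_ae_iff_prob_eq_one (measurableSet_lt_sum b 0)]
    filter_upwards [expPi_ae_pos n] with z hz
    exact Finset.sum_pos' (fun i _ => mul_nonneg (hb i) (hz i).le)
      ⟨i, Finset.mem_univ i, mul_pos hi (hz i)⟩
  rw [measureReal_def, h, ENNReal.toReal_one]

/-- The coefficients of the mixture of exponential tails which is the tail of a linear
combination of independent standard exponential variables. -/
noncomputable def mixCoeff {n : ℕ} (b : Fin n → ℝ) (i : Fin n) : ℝ :=
  ∏ j, if j = i then 1 else b i / (b i - b j)

theorem mixCoeff_castSucc {n : ℕ} (b : Fin (n + 1) → ℝ) (i : Fin n) :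
    mixCoeff b i.castSucc = mixCoeff (fun j => b j.castSucc) i *
      (b i.castSucc / (b i.castSucc - b (Fin.last n))) := by
  rw [mixCoeff, Fin.prod_univ_castSucc, mixCoeff]
  simp [(Fin.castSucc_lt_last i).ne']

/-- The coefficients are the Lagrange basis polynomials for the nodes 1 / b_i, evaluated at 0, and
the basis polynomials sum to 1. -/
theorem sum_mixCoeff {n : ℕ} {b : Fin (n + 1) → ℝ} (hb : ∀ i, b i ≠ 0)
    (hinj : Function.Injective b) : ∑ i, mixCoeff b i = 1 := by
  have h := Lagrange.sum_basis (s := Finset.univ) (v := fun i => (b i)⁻¹)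
    (fun i _ j _ hij => hinj (inv_injective hij)) Finset.univ_nonempty
  have h' := congrArg (Polynomial.eval 0) h
  rw [Polynomial.eval_finsetSum, Polynomial.eval_one] at h'
  rw [← h']
  refine Finset.sum_congr rfl fun i _ => ?_
  rw [Lagrange.basis, Polynomial.eval_prod, mixCoeff,
    ← Finset.mul_prod_erase _ _ (Finset.mem_univ i)]
  simp only [if_true, one_mul]
  refine Finset.prod_congr rfl fun j hj => ?_
  have hij : j ≠ i := Finset.ne_of_mem_erase hj
  have h1 : b i - b j ≠ 0 := sub_ne_zero.2 fun h => hij (hinj h).symm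
  have h2 : (b i)⁻¹ - (b j)⁻¹ ≠ 0 := sub_ne_zero.2 fun h => hij (hinj (inv_injective h)).symm
  have hi := hb i
  have hj := hb j
  simp only [hij, if_false, Lagrange.basisDivisor, Polynomial.eval_mul, Polynomial.eval_C,
    Polynomial.eval_sub, Polynomial.eval_X]
  rw [eq_comm, inv_mul_eq_div, div_eq_div_iff h2 h1]
  field_simp
  ring

theorem setIntegral_exp_neg_mul_Ioc {κ T : ℝ} (hκ : 0 < κ) (hT : 0 ≤ T) :
    ∫ e in Set.Ioc 0 T, Real.exp (-κ * e) = (1 - Real.exp (-κ * T)) / κ := by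
  have hi := fun c => integrableOn_exp_mul_Ioi (neg_lt_zero.2 hκ) c
  have h := setIntegral_union (μ := volume) (f := fun e => Real.exp (-κ * e))
    (Set.Ioc_disjoint_Ioi (a := 0) (le_refl T)) measurableSet_Ioi
    ((hi 0).mono_set Set.Ioc_subset_Ioi_self) (hi T)
  rw [Set.Ioc_union_Ioi_eq_Ioi hT, integral_exp_mul_Ioi (neg_lt_zero.2 hκ),
    integral_exp_mul_Ioi (neg_lt_zero.2 hκ)] at h
  rw [eq_sub_of_add_eq h.symm]
  simp
  field_simp

/-- The tail of a linear combination of independent standard exponential variables whose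
positive coefficients are distinct. -/
theorem expPi_real_lt_sum {n : ℕ} {b : Fin n → ℝ} (hb : Antitone b)
    (hs : ∀ i j, i < j → 0 < b i → b j < b i) {t : ℝ} (ht : 0 ≤ t) :
    (expPi n).real {z | t < ∑ i, b i * z i} =
      ∑ i, if 0 < b i then mixCoeff b i * Real.exp (-(t / b i)) else 0 := by
  -- Condition on the last variable e, whose coefficient β is the smallest. The others must then
  -- exceed t - βe. Ties between nonpositive coefficients are allowed: they never enter as b_i - b_j
  -- = 0 with b_i > 0.
  induction n generalizing t with
  | zero => simp [not_lt.2 ht]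
  | succ n ih =>
    set b' : Fin n → ℝ := fun i => b i.castSucc with hb'
    set β := b (Fin.last n) with hβ
    have ih' := fun {t : ℝ} (ht : 0 ≤ t) => ih (b := b')
      (fun i j hij => hb (Fin.castSucc_le_castSucc_iff.2 hij))
      (fun i j hij => hs _ _ (Fin.castSucc_lt_castSucc_iff.2 hij)) ht
    have hlt : ∀ i, 0 < b' i → β < b' i := fun i hi => hs _ _ (Fin.castSucc_lt_last i) hi
    have hset : ∀ e : ℝ, {w : Fin n → ℝ | (Fin.snoc (α := fun _ => ℝ) w e : Fin (n + 1) → ℝ) ∈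
        {z : Fin (n + 1) → ℝ | t < ∑ i, b i * z i}} = {w | t - β * e < ∑ i, b' i * w i} := by
      intro e
      ext w
      simp [Fin.sum_univ_castSucc, sub_lt_iff_lt_add, b', β]
    rw [expPi_succ_real (measurableSet_lt_sum b t)]
    simp_rw [hset]
    have hform : ∀ e : ℝ, 0 ≤ t - β * e → Real.exp (-e) *
        (expPi n).real {w | t - β * e < ∑ i, b' i * w i} =
        ∑ i, (if 0 < b' i then mixCoeff b' i * Real.exp (-(t / b' i)) else 0) *
          Real.exp (-(1 - β / b' i) * e) := by
      intro e he
      rw [ih' he, Finset.mul_sum]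
      refine Finset.sum_congr rfl fun i _ => ?_
      split_ifs with hi
      · rw [mul_left_comm, mul_assoc, ← Real.exp_add, ← Real.exp_add]
        congr 2
        field_simp
        ring
      · simp
    have hκ : ∀ i, 0 < b' i → 0 < 1 - β / b' i := fun i hi => by
      rw [sub_pos, div_lt_one hi]; exact hlt i hi
    have hκ' : ∀ i, 0 < b' i → (1 - β / b' i)⁻¹ = b' i / (b' i - β) := fun i hi => by
      rw [one_sub_div hi.ne', inv_div]
    have hint : ∀ c : ℝ, ∀ i, IntegrableOn (fun e =>
        (if 0 < b' i then mixCoeff b' i * Real.exp (-(t / b' i)) else 0) *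
          Real.exp (-(1 - β / b' i) * e)) (Set.Ioi c) := by
      intro c i
      split_ifs with hi
      · exact (integrableOn_exp_mul_Ioi (neg_lt_zero.2 (hκ i hi)) c).const_mul _
      · simp
    rw [Fin.sum_univ_castSucc]
    -- For β > 0 the threshold t - βe turns negative at e = t / β; beyond that the remaining sum
    -- exceeds it almost surely, so the integral is split there.
    by_cases hβ0 : 0 < β
    · have hpos : ∀ i, 0 < b' i := fun i => hβ0.trans_le (hb (Fin.castSucc_lt_last i).le)
      have hT : 0 ≤ t / β := by positivity
      have hge : ∀ e ∈ Set.Ioc 0 (t / β), 0 ≤ t - β * e := fun e he => by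
        have := (le_div_iff₀' hβ0).1 he.2
        linarith
      have hEq1 : Set.EqOn (fun e => Real.exp (-e) *
          (expPi n).real {w | t - β * e < ∑ i, b' i * w i}) (fun e =>
          ∑ i, (if 0 < b' i then mixCoeff b' i * Real.exp (-(t / b' i)) else 0) *
          Real.exp (-(1 - β / b' i) * e)) (Set.Ioc 0 (t / β)) := fun e he => hform e (hge e he)
      have hEq2 : Set.EqOn (fun e => Real.exp (-e) *
          (expPi n).real {w | t - β * e < ∑ i, b' i * w i}) (fun e =>
          Real.exp (-1 * e)) (Set.Ioi (t / β)) := fun e he => by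
        have := (div_lt_iff₀' hβ0).1 he
        simp only
        rw [expPi_real_lt_sum_of_neg (fun i => (hpos i).le) (by linarith), mul_one, neg_one_mul]
      have hI1 : IntegrableOn (fun e => ∑ i, (if 0 < b' i then
          mixCoeff b' i * Real.exp (-(t / b' i)) else 0) *
          Real.exp (-(1 - β / b' i) * e)) (Set.Ioc 0 (t / β)) :=
        integrable_finsetSum _ fun i _ => (hint 0 i).mono_set Set.Ioc_subset_Ioi_self
      have hI2 : IntegrableOn (fun e => Real.exp (-1 * e)) (Set.Ioi (t / β)) :=
        integrableOn_exp_mul_Ioi (by norm_num) _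
      rw [← Set.Ioc_union_Ioi_eq_Ioi hT, setIntegral_union (Set.Ioc_disjoint_Ioi le_rfl)
        measurableSet_Ioi (hI1.congr_fun hEq1.symm measurableSet_Ioc)
        (hI2.congr_fun hEq2.symm measurableSet_Ioi),
        setIntegral_congr_fun measurableSet_Ioc hEq1, setIntegral_congr_fun measurableSet_Ioi hEq2,
        integral_finsetSum _ fun i _ => (hint 0 i).mono_set Set.Ioc_subset_Ioi_self,
        integral_exp_mul_Ioi (by norm_num)]
      -- The integration leaves exp(-t/β) with coefficient 1 minus the other mixing coefficients,
      -- which is the last mixing coefficient.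
      have hsum := sum_mixCoeff (b := b) (fun i => (hβ0.trans_le (hb (Fin.le_last i))).ne')
        (by
          intro i j hij
          by_contra hne
          rcases lt_or_gt_of_ne hne with h | h
          · exact (hs i j h (hβ0.trans_le (hb (Fin.le_last i)))).ne hij.symm
          · exact (hs j i h (hβ0.trans_le (hb (Fin.le_last j)))).ne hij)
      rw [Fin.sum_univ_castSucc] at hsum
      have hterm : ∀ i, ∫ e in Set.Ioc 0 (t / β), (if 0 < b' i then
          mixCoeff b' i * Real.exp (-(t / b' i)) else 0) * Real.exp (-(1 - β / b' i) * e) =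
          mixCoeff b i.castSucc * (Real.exp (-(t / b' i)) - Real.exp (-(t / β))) := by
        intro i
        have hne := (hpos i).ne'
        rw [if_pos (hpos i), integral_const_mul, setIntegral_exp_neg_mul_Ioc (hκ i (hpos i)) hT,
          mixCoeff_castSucc, div_eq_mul_inv _ (1 - β / b' i), hκ' i (hpos i)]
        have : Real.exp (-(t / β)) =
            Real.exp (-(t / b' i)) * Real.exp (-(1 - β / b' i) * (t / β)) := by
          rw [← Real.exp_add]
          congr 1
          field_simp
          ring
        rw [this]
        ring
      simp_rw [hterm]
      rw [if_pos hβ0, eq_sub_of_add_eq' hsum]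
      simp only [← hβ, hpos, if_true, mul_sub, Finset.sum_sub_distrib, ← Finset.sum_mul, sub_mul,
        show ∀ i, b (Fin.castSucc i) = b' i from fun _ => rfl]
      ring_nf
    -- Here the threshold never becomes negative, so the induction hypothesis applies on the whole
    -- half-line and no new term appears.
    · have hβ1 : β ≤ 0 := not_lt.1 hβ0
      rw [setIntegral_congr_fun measurableSet_Ioi (fun e he => hform e (by
        have he' : (0 : ℝ) < e := he
        nlinarith)), integral_finsetSum _ fun i _ => hint 0 i, if_neg hβ0, add_zero]
      refine Finset.sum_congr rfl fun i _ => ?_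
      change _ = if 0 < b' i then mixCoeff b i.castSucc * Real.exp (-(t / b' i)) else 0
      split_ifs with hi
      · rw [integral_const_mul, integral_exp_mul_Ioi (neg_lt_zero.2 (hκ i hi)), mixCoeff_castSucc,
          mul_zero, Real.exp_zero, neg_div_neg_eq, one_div, hκ' i hi]
        ring
      · simp

/-! ### From a tail function to a nonnegative density. -/

theorem H_of_mem {x a b : ℝ} (h : x ∈ Set.Icc a b) : H x a b = 1 := Set.indicator_of_mem h _

theorem H_of_notMem {x a b : ℝ} (h : x ∉ Set.Icc a b) : H x a b = 0 := Set.indicator_of_notMem h _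

/-- The density of a scaled beta variable, up to normalisation. -/
noncomputable def kernelPdf (N : ℕ) (γ x : ℝ) : ℝ := (1 - x / γ) ^ (N - 1) * H x 0 γ

/-- The tail function belonging to `kernelPdf`. -/
noncomputable def kernelTail (N : ℕ) (γ x : ℝ) : ℝ := γ / N * (1 - x / γ) ^ N * H x 0 γ

theorem measurable_kernelPdf (N : ℕ) (γ : ℝ) : Measurable (kernelPdf N γ) := by
  have : Measurable fun x => H x 0 γ := measurable_one.indicator measurableSet_Icc
  unfold kernelPdf
  fun_prop

theorem kernelPdf_eq_indicator (N : ℕ) (γ : ℝ) :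
    kernelPdf N γ = (Set.Icc 0 γ).indicator fun x => (1 - x / γ) ^ (N - 1) := by
  ext x
  by_cases h : x ∈ Set.Icc 0 γ
  · simp [kernelPdf, H_of_mem h, h]
  · simp [kernelPdf, H_of_notMem h, h]

theorem integrable_kernelPdf (N : ℕ) (γ : ℝ) : Integrable (kernelPdf N γ) := by
  rw [kernelPdf_eq_indicator, integrable_indicator_iff measurableSet_Icc]
  exact (by fun_prop : Continuous fun x : ℝ => (1 - x / γ) ^ (N - 1)).integrableOn_Icc

theorem hasDerivAt_kernel {N : ℕ} (hN : 1 ≤ N) {γ : ℝ} (hγ : 0 < γ) (x : ℝ) :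
    HasDerivAt (fun x => γ / N * (1 - x / γ) ^ N) (-(1 - x / γ) ^ (N - 1)) x := by
  have h1 : HasDerivAt (fun x : ℝ => 1 - x / γ) (-(1 / γ)) x :=
    ((hasDerivAt_id x).div_const γ).const_sub 1
  refine ((h1.fun_pow N).const_mul (γ / N)).congr_deriv ?_
  have : (N : ℝ) ≠ 0 := by positivity
  field_simp

theorem setIntegral_Ioi_kernelPdf {N : ℕ} (hN : 1 ≤ N) {γ : ℝ} (hγ : 0 < γ) (x : ℝ) :
    ∫ y in Set.Ioi x, kernelPdf N γ y = kernelTail N γ (max x 0) := by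
  have hN0 : N ≠ 0 := by omega
  have key : ∀ a ≤ γ, ∫ y in Set.Ioc a γ, (1 - y / γ) ^ (N - 1) = γ / N * (1 - a / γ) ^ N := by
    intro a ha
    have h := intervalIntegral.integral_eq_sub_of_hasDerivAt (a := a) (b := γ)
      (fun y _ => hasDerivAt_kernel hN hγ y)
      ((by fun_prop : Continuous fun y : ℝ => -(1 - y / γ) ^ (N - 1)).intervalIntegrable _ _)
    rw [intervalIntegral.integral_neg, intervalIntegral.integral_of_le ha, div_self hγ.ne'] at h
    simp only [sub_self, zero_pow hN0, mul_zero, zero_sub, neg_inj] at h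
    exact h
  rw [kernelPdf_eq_indicator, setIntegral_indicator measurableSet_Icc]
  rcases le_or_gt 0 x with hx | hx
  · rw [max_eq_left hx]
    have hset : Set.Ioi x ∩ Set.Icc 0 γ = Set.Ioc x γ := by
      ext y
      simp only [Set.mem_inter_iff, Set.mem_Ioi, Set.mem_Icc, Set.mem_Ioc]
      constructor
      · rintro ⟨h1, -, h2⟩; exact ⟨h1, h2⟩
      · rintro ⟨h1, h2⟩; exact ⟨h1, hx.trans h1.le, h2⟩
    rw [hset]
    rcases le_or_gt x γ with h | h
    · rw [key x h, kernelTail, H_of_mem ⟨hx, h⟩, mul_one]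
    · rw [Set.Ioc_eq_empty h.not_gt, kernelTail, H_of_notMem (fun h' => h.not_ge h'.2)]
      simp
  · rw [max_eq_right hx.le]
    have hset : Set.Ioi x ∩ Set.Icc 0 γ = Set.Icc 0 γ :=
      Set.inter_eq_right.2 fun y hy => hx.trans_le hy.1
    rw [hset, integral_Icc_eq_integral_Ioc, key 0 hγ.le, kernelTail, H_of_mem ⟨le_rfl, hγ.le⟩,
      mul_one]

/-- One-sided derivative of the tail, from the left at positive points. -/
theorem hasDerivWithinAt_kernelTail_left {N : ℕ} (hN : 1 ≤ N) {γ : ℝ} (hγ : 0 < γ) {x : ℝ}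
    (hx : 0 < x) : HasDerivWithinAt (kernelTail N γ) (-kernelPdf N γ x) (Set.Icc 0 x) x := by
  rcases le_or_gt x γ with h | h
  · have h1 := (hasDerivAt_kernel hN hγ x).hasDerivWithinAt (s := Set.Icc 0 x)
    have h2 : ∀ y ∈ Set.Icc 0 x, kernelTail N γ y = γ / N * (1 - y / γ) ^ N := fun y hy => by
      rw [kernelTail, H_of_mem ⟨hy.1, hy.2.trans h⟩, mul_one]
    refine (h1.congr h2 (h2 x ⟨hx.le, le_rfl⟩)).congr_deriv ?_
    rw [kernelPdf, H_of_mem ⟨hx.le, h⟩, mul_one]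
  · have h1 : kernelTail N γ =ᶠ[nhds x] fun _ => 0 := by
      filter_upwards [Ioi_mem_nhds h] with y hy
      rw [kernelTail, H_of_notMem (fun h' => (not_le.2 hy) h'.2), mul_zero]
    refine ((hasDerivAt_const x (0 : ℝ)).congr_of_eventuallyEq h1).hasDerivWithinAt.congr_deriv ?_
    rw [kernelPdf, H_of_notMem (fun h' => h.not_ge h'.2), mul_zero, neg_zero]

/-- One-sided derivative of the tail at the origin. -/
theorem hasDerivWithinAt_kernelTail_zero {N : ℕ} (hN : 1 ≤ N) {γ : ℝ} (hγ : 0 < γ) :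
    HasDerivWithinAt (kernelTail N γ) (-kernelPdf N γ 0) (Set.Ici 0) 0 := by
  have h1 := (hasDerivAt_kernel hN hγ 0).hasDerivWithinAt (s := Set.Ici 0)
  have h2 : kernelTail N γ =ᶠ[nhdsWithin 0 (Set.Ici 0)] fun y => γ / N * (1 - y / γ) ^ N := by
    filter_upwards [self_mem_nhdsWithin, mem_nhdsWithin_of_mem_nhds (Iic_mem_nhds hγ)] with y h h'
    rw [kernelTail, H_of_mem ⟨h, h'⟩, mul_one]
  refine (h1.congr_of_eventuallyEq h2
    (h2.eq_of_nhdsWithin (Set.mem_Ici.2 le_rfl))).congr_deriv ?_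
  rw [kernelPdf, H_of_mem ⟨le_rfl, hγ.le⟩, mul_one]

/-- A law on the real line with a tail that is a combination of `kernelTail`s on the positive
half-line has the corresponding combination of `kernelPdf`s as a nonnegative density. -/
theorem eq_withDensity_of_tail {ι : Type*} {s : Finset ι} {N : ℕ} (hN : 1 ≤ N) {E γ : ι → ℝ}
    (hγ : ∀ i ∈ s, 0 < γ i) (μ : Measure ℝ) [IsProbabilityMeasure μ]
    (hμ : ∀ x, 0 ≤ x → μ.real (Set.Ioi x) = ∑ i ∈ s, E i * kernelTail N (γ i) x)
    (h0 : μ.real (Set.Ioi 0) = 1) :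
    (∀ x, 0 ≤ ∑ i ∈ s, E i * kernelPdf N (γ i) x) ∧
      μ = volume.withDensity fun x => ENNReal.ofReal (∑ i ∈ s, E i * kernelPdf N (γ i) x) := by
  set f : ℝ → ℝ := fun x => ∑ i ∈ s, E i * kernelPdf N (γ i) x with hf
  set G : ℝ → ℝ := fun x => ∑ i ∈ s, E i * kernelTail N (γ i) x with hG
  replace hμ : ∀ x, 0 ≤ x → μ.real (Set.Ioi x) = G x := hμ
  have hanti : AntitoneOn G (Set.Ici 0) := fun x hx y hy hxy => by
    rw [← hμ x hx, ← hμ y hy]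
    exact measureReal_mono (Set.Ioi_subset_Ioi hxy)
  have hneg : ∀ x < 0, f x = 0 := fun x hx => Finset.sum_eq_zero fun i _ => by
    rw [kernelPdf, H_of_notMem (fun h => hx.not_ge h.1), mul_zero, mul_zero]
  -- Nonnegativity is needed at every point, including the jumps of f. Since `H` uses closed
  -- intervals, -f is the left derivative of G at x > 0 and its right derivative at 0, and G is
  -- decreasing.
  have hnonneg : ∀ x, 0 ≤ f x := by
    intro x
    rcases lt_trichotomy x 0 with hx | rfl | hx
    · exact (hneg x hx).ge
    · have h : HasDerivWithinAt G (-f 0) (Set.Ici 0) 0 := by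
        have := HasDerivWithinAt.fun_sum fun i (hi : i ∈ s) =>
          (hasDerivWithinAt_kernelTail_zero hN (hγ i hi)).const_mul (E i)
        simpa [f, Finset.sum_neg_distrib] using this
      have h1 := hanti.derivWithin_nonpos (x := 0)
      rw [h.derivWithin (uniqueDiffWithinAt_Ici 0)] at h1
      linarith
    · have h : HasDerivWithinAt G (-f x) (Set.Icc 0 x) x := by
        have := HasDerivWithinAt.fun_sum fun i (hi : i ∈ s) =>
          (hasDerivWithinAt_kernelTail_left hN (hγ i hi) hx).const_mul (E i)
        simpa [f, Finset.sum_neg_distrib] using this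
      have h1 := (hanti.mono fun y (hy : y ∈ Set.Icc 0 x) => hy.1).derivWithin_nonpos (x := x)
      rw [h.derivWithin (uniqueDiffOn_Icc hx x ⟨hx.le, le_rfl⟩)] at h1
      linarith
  refine ⟨hnonneg, ?_⟩
  have hint : Integrable f := integrable_finsetSum _ fun i _ => (integrable_kernelPdf _ _).const_mul _
  have hμ' : ∀ x, μ.real (Set.Ioi x) = G (max x 0) := by
    intro x
    rcases le_or_gt 0 x with hx | hx
    · rw [max_eq_left hx, hμ x hx]
    · rw [max_eq_right hx.le, ← hμ 0 le_rfl, h0]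
      refine le_antisymm measureReal_le_one ?_
      rw [← h0]
      exact measureReal_mono (Set.Ioi_subset_Ioi hx.le)
  have hIoi : ∀ x, μ (Set.Ioi x) =
      (volume.withDensity fun x => ENNReal.ofReal (f x)) (Set.Ioi x) := by
    intro x
    rw [withDensity_apply _ measurableSet_Ioi, ← ofReal_integral_eq_lintegral_ofReal
      hint.integrableOn (Filter.Eventually.of_forall hnonneg), ← ofReal_measureReal, hμ' x]
    congr 1
    rw [hf, integral_finsetSum _ fun i _ => ((integrable_kernelPdf _ _).const_mul _).integrableOn]
    exact Finset.sum_congr rfl fun i hi => by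
      rw [integral_const_mul, setIntegral_Ioi_kernelPdf hN (hγ i hi)]
  refine ext_of_generate_finite _ (borel_eq_generateFrom_Ioi ℝ ▸ BorelSpace.measurable_eq)
    isPiSystem_Ioi ?_ ?_
  · rintro _ ⟨x, rfl⟩
    exact hIoi x
  -- Half-lines are a π-system but do not contain the whole line; total masses are compared through
  -- Ioi (-1), whose complement is null for both measures.
  · have h1 : μ Set.univ = μ (Set.Ioi (-1)) := by
      have : μ.real (Set.Ioi (-1)) = 1 := by
        rw [hμ' (-1), max_eq_right (by norm_num), ← hμ 0 le_rfl, h0]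
      rw [← ofReal_measureReal (s := Set.Ioi (-1)), this]
      simp
    have h2 : (volume.withDensity fun x => ENNReal.ofReal (f x)) (Set.Iic (-1)) = 0 := by
      rw [withDensity_apply _ measurableSet_Iic, setLIntegral_congr_fun (g := fun _ => 0)
        measurableSet_Iic fun x hx => by
          simp [hneg x (lt_of_le_of_lt hx (by norm_num))]]
      simp
    rw [h1, hIoi, ← Set.Iic_union_Ioi (a := (-1 : ℝ)),
      measure_union (Set.Iic_disjoint_Ioi le_rfl) measurableSet_Ioi, h2, zero_add]

/-! ### The coefficients for the smallest spacings. -/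

/-- The coefficient of the `i`-th normalised increment (counted from `0`) in the sum of the `m`
smallest of `N + 1` exponential variables. -/
noncomputable def ratio (N m i : ℕ) : ℝ := ((m - i : ℕ) : ℝ) / (((N + 1 : ℕ) : ℝ) - i)

theorem sum_Ici_ite_lt {N m : ℕ} (hm : m ≤ N + 1) (i : Fin (N + 1)) :
    (∑ j ∈ Finset.Ici i, if j.val < m then (1 : ℝ) else 0) = ((m - i : ℕ) : ℝ) := by
  rw [Finset.sum_boole, ← Nat.card_Ico, ← Finset.card_map Fin.valEmbedding]
  congr 2
  ext j
  simp only [Finset.mem_map, Finset.mem_filter, Finset.mem_Ici, Fin.valEmbedding_apply,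
    Finset.mem_Ico, Fin.le_def]
  constructor
  · rintro ⟨j, ⟨h1, h2⟩, rfl⟩; exact ⟨h1, h2⟩
  · rintro ⟨h1, h2⟩; exact ⟨⟨j, h2.trans_le hm⟩, ⟨h1, h2⟩, rfl⟩

theorem ratio_of_ge {N m i : ℕ} (h : m ≤ i) : ratio N m i = 0 := by
  simp [ratio, Nat.sub_eq_zero_of_le h]

theorem ratio_pos {N m i : ℕ} (hm : m ≤ N) (h : i < m) : 0 < ratio N m i := by
  rw [ratio]
  have h1 : (0 : ℝ) < ((m - i : ℕ) : ℝ) := by exact_mod_cast Nat.sub_pos_of_lt h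
  have h2 : (0 : ℝ) < ((N + 1 : ℕ) : ℝ) - i := sub_pos.2 (by exact_mod_cast (by omega : i < N + 1))
  positivity

theorem ratio_nonneg {N m : ℕ} (hm : m ≤ N) (i : ℕ) : 0 ≤ ratio N m i := by
  rcases lt_or_ge i m with h | h
  · exact (ratio_pos hm h).le
  · exact (ratio_of_ge h).ge

/-- The numerator collapses to (j-i)(N+1-m). The factored form lets the product over j split into
closed-form products. -/
theorem ratio_sub_ratio {N m i j : ℕ} (hm : m ≤ N) (hi : i < m) (hj : j < m) :
    ratio N m i - ratio N m j =
      ((j : ℝ) - i) * (((N : ℝ) + 1 - m) / ((N : ℝ) + 1 - i)) / ((N : ℝ) + 1 - j) := by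
  have h1 : (0 : ℝ) < (N : ℝ) + 1 - i :=
    sub_pos.2 (by exact_mod_cast (by omega : i < N + 1))
  have h2 : (0 : ℝ) < (N : ℝ) + 1 - j :=
    sub_pos.2 (by exact_mod_cast (by omega : j < N + 1))
  rw [ratio, ratio, Nat.cast_sub hi.le, Nat.cast_sub hj.le]
  push_cast
  field_simp
  ring

theorem ratio_lt {N m i j : ℕ} (hm : m ≤ N) (hij : i < j) (hi : i < m) :
    ratio N m j < ratio N m i := by
  rcases lt_or_ge j m with hj | hj
  · rw [← sub_pos, ratio_sub_ratio hm hi hj]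
    have h1 : (0 : ℝ) < (N : ℝ) + 1 - i := sub_pos.2 (by exact_mod_cast (by omega : i < N + 1))
    have h2 : (0 : ℝ) < (N : ℝ) + 1 - j := sub_pos.2 (by exact_mod_cast (by omega : j < N + 1))
    have h3 : (0 : ℝ) < (N : ℝ) + 1 - m := sub_pos.2 (by exact_mod_cast (by omega : m < N + 1))
    have h4 : (0 : ℝ) < (j : ℝ) - i := sub_pos.2 (by exact_mod_cast hij)
    positivity
  · rw [ratio_of_ge hj]
    exact ratio_pos hm hi

theorem ratio_antitone {N m : ℕ} (hm : m ≤ N) : Antitone (ratio N m) := by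
  intro i j hij
  rcases hij.eq_or_lt with rfl | h
  · exact le_rfl
  · rcases lt_or_ge i m with hi | hi
    · exact (ratio_lt hm h hi).le
    · rw [ratio_of_ge hi, ratio_of_ge (hi.trans hij)]

/-! ### Reduction of the small-spacing sum to exponentials. -/

theorem sum_spacing {N : ℕ} (x : Fin N → ℝ) : ∑ j, spacing x j = 1 := by
  have h : ∀ {n : ℕ} (y : Fin (n + 1) → ℝ),
      ∑ j : Fin n, (y j.succ - y j.castSucc) = y (Fin.last n) - y 0 := by
    intro n
    induction n with
    | zero => intro y; simp
    | succ n ih =>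
      intro y
      rw [Fin.sum_univ_castSucc]
      have := ih fun j => y j.castSucc
      simp only [Fin.succ_castSucc] at this ⊢
      rw [this]
      simp
  rw [show ∑ j, spacing x j = ∑ j : Fin (N + 1), (extended x j.succ - extended x j.castSucc)
    from rfl, h]
  simp [extended]

/-- Total spacing 1 absorbs the constant t into the weights, making the condition t < s_m
homogeneous. -/
theorem sum_ite_sub_mul_sorted {N m : ℕ} (x : Fin N → ℝ) (t : ℝ) :
    ∑ j : Fin (N + 1), ((if j.val < m then 1 else 0) - t) * sorted (spacing x) j =
      minSum m x - t := by
  simp only [sub_mul, Finset.sum_sub_distrib, ← Finset.mul_sum, sum_sorted, sum_spacing, mul_one,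
    ite_mul, one_mul, zero_mul, minSum, Finset.sum_filter]

theorem measurable_minSum {N : ℕ} (m : ℕ) : Measurable (minSum m : (Fin N → ℝ) → ℝ) :=
  Finset.measurable_sum _ fun j _ => (measurable_sorted j).comp measurable_spacing

theorem volume_lt_minSum {N m : ℕ} (hm : m ≤ N) (t : ℝ) :
    volume {x : Fin N → ℝ | (∀ i, 0 < x i ∧ x i < 1) ∧ t < minSum m x} =
      expPi (N + 1) {z | 0 < ∑ i : Fin (N + 1), (ratio N m i - t) * z i} := by
  set w : Fin (N + 1) → ℝ := fun j => (if j.val < m then 1 else 0) - t with hw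
  have h1 : MeasurableSet {y : Fin (N + 1) → ℝ | 0 < ∑ j, w j * sorted y j} :=
    measurableSet_lt measurable_const
      (Finset.measurable_sum _ fun j _ => (measurable_sorted j).const_mul _)
  have h2 := volume_spacing_mem h1 fun s hs y => by
    simp only [Set.mem_ofPred_eq, sorted_smul hs, Pi.smul_apply, smul_eq_mul, mul_left_comm _ s,
      ← Finset.mul_sum, mul_pos_iff_of_pos_left hs]
  rw [expPi_sorted] at h2
  have h3 : ∀ i : Fin (N + 1),
      (∑ j ∈ Finset.Ici i, w j) / (((N + 1 : ℕ) : ℝ) - i) = ratio N m i - t := by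
    intro i
    have hd : ((N + 1 : ℕ) : ℝ) - i ≠ 0 := (sub_pos.2 (by exact_mod_cast i.2)).ne'
    rw [hw, Finset.sum_sub_distrib, sum_Ici_ite_lt (hm.trans N.le_succ)]
    have := card_Ici_fin i
    simp only [Finset.sum_const, nsmul_eq_mul, mul_one] at this ⊢
    rw [this, sub_div, mul_div_cancel_left₀ _ hd, ratio]
  simp only [h3] at h2
  rw [← h2]
  congr 1
  ext x
  simp only [Set.mem_ofPred_eq, hw, sum_ite_sub_mul_sorted, sub_pos]

/-! ### Evaluation of the mixing coefficients. -/

/-- The reciprocal of the product of the differences between the `i`-th ratio and the others. -/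
noncomputable def ratioWeight (N m i : ℕ) : ℝ :=
  ∏ j ∈ Finset.range (N + 1), if j = i then 1 else (ratio N m i - ratio N m j)⁻¹

/-- The shift by t cancels in every denominator, so t survives only in the N equal numerators. -/
theorem mixCoeff_ratio_sub {N m : ℕ} (t : ℝ) (i : Fin (N + 1)) :
    mixCoeff (fun j : Fin (N + 1) => ratio N m j - t) i =
      (ratio N m i - t) ^ N * ratioWeight N m i := by
  rw [ratioWeight, Finset.prod_range, mixCoeff]
  have h : (ratio N m i - t) ^ N = ∏ j : Fin (N + 1), if j = i then 1 else (ratio N m i - t) := by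
    rw [← Finset.mul_prod_erase _ _ (Finset.mem_univ i), Finset.prod_congr rfl
      fun j hj => if_neg (Finset.ne_of_mem_erase hj)]
    simp
  rw [h, ← Finset.prod_mul_distrib]
  refine Finset.prod_congr rfl fun j _ => ?_
  by_cases hj : j = i
  · simp [hj]
  · have : (j : ℕ) ≠ i := fun h => hj (Fin.ext h)
    simp [hj, this, div_eq_mul_inv]

theorem prod_range_ite_sub {m i : ℕ} (hi : i < m) :
    ∏ j ∈ Finset.range m, (if j = i then (1 : ℝ) else (j : ℝ) - i) =
      (-1) ^ i * i ! * (m - 1 - i)! := by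
  induction m, hi using Nat.le_induction with
  | base =>
    rw [Finset.prod_range_succ, if_pos rfl, mul_one, ← prod_fin_sub, Finset.prod_range,
      show ((-1 : ℝ)) ^ i = ∏ _j : Fin i, (-1 : ℝ) by simp, ← Finset.prod_mul_distrib]
    simp only [Nat.succ_eq_add_one, Nat.add_sub_cancel, Nat.sub_self, Nat.factorial_zero,
      Nat.cast_one, mul_one]
    refine Finset.prod_congr rfl fun j _ => ?_
    rw [if_neg j.2.ne]
    ring
  | succ m hm ih =>
    have hm' : i < m := hm
    rw [Finset.prod_range_succ, ih, if_neg hm'.ne', show m + 1 - 1 - i = (m - 1 - i) + 1 by omega,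
      Nat.factorial_succ, show m - 1 - i + 1 = m - i by omega]
    push_cast [hm'.le]
    ring

theorem prod_range_ite_const {m i : ℕ} (hi : i < m) (q : ℝ) :
    ∏ j ∈ Finset.range m, (if j = i then (1 : ℝ) else q) = q ^ (m - 1) := by
  have hmem := Finset.mem_range.2 hi
  rw [← Finset.mul_prod_erase _ _ hmem, Finset.prod_congr rfl
    fun j hj => if_neg (Finset.ne_of_mem_erase hj)]
  simp [Finset.card_erase_of_mem hmem]

theorem prod_range_ite_top_sub {n m i : ℕ} (hm : m ≤ n) (hi : i < m) :
    (∏ j ∈ Finset.range m, (if j = i then (1 : ℝ) else (n : ℝ) - j)) * ((n : ℝ) - i) *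
      (n - m)! = n ! := by
  have hmem := Finset.mem_range.2 hi
  rw [← Nat.factorial_mul_descFactorial hm, Nat.descFactorial_eq_prod_range]
  push_cast
  rw [mul_comm]
  congr 1
  rw [← Finset.mul_prod_erase _ _ hmem, if_pos rfl, one_mul,
    Finset.prod_congr rfl fun j hj => if_neg (Finset.ne_of_mem_erase hj),
    Finset.prod_erase_mul _ _ hmem]
  refine Finset.prod_congr rfl fun j hj => ?_
  rw [Nat.cast_sub ((Finset.mem_range.1 hj).le.trans hm)]

/-- In the product defining `ratioWeight`, the indices j < m give factorials and powers through
`ratio_sub_ratio`; each of the N+1-m indices j ≥ m has ratio 0 and contributes the inverse of the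
i-th ratio. -/
theorem coeffA_mul_coeffa {N m i : ℕ} (hm : m ≤ N) (hi : i < m) :
    coeffA m N * coeffa (i + 1) m = N * ratioWeight N m i * ratio N m i ^ (N - 1) := by
  -- Writing m = p+1 and N = p+q+1 removes the truncated subtractions; the integer exponent m-2
  -- becomes p-1, which is -1 when p = 0.
  obtain ⟨p, rfl⟩ : ∃ p, m = p + 1 := ⟨m - 1, by omega⟩
  obtain ⟨q, rfl⟩ : ∃ q, N = p + q + 1 := ⟨N - p - 1, by omega⟩
  set n : ℕ := p + q + 1 + 1
  have hiN : (0 : ℝ) < (n : ℝ) - i := sub_pos.2 (by exact_mod_cast (by omega : i < p + q + 1 + 1))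
  have hM : (0 : ℝ) < (p : ℝ) + 1 - i := sub_pos.2 (by exact_mod_cast hi)
  have hc : ratio (p + q + 1) (p + 1) i = ((p : ℝ) + 1 - i) / ((n : ℝ) - i) := by
    rw [ratio, Nat.cast_sub hi.le, Nat.cast_add_one p]
  have hW : (ratioWeight (p + q + 1) (p + 1) i)⁻¹ =
      ((-1) ^ i * i ! * (p - i)!) * (((q : ℝ) + 1) / ((n : ℝ) - i)) ^ p /
        (∏ j ∈ Finset.range (p + 1), (if j = i then (1 : ℝ) else (n : ℝ) - j)) *
        (((p : ℝ) + 1 - i) / ((n : ℝ) - i)) ^ (q + 1) := by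
    have h1 := prod_range_ite_sub hi
    have h2 := prod_range_ite_const hi (((q : ℝ) + 1) / ((n : ℝ) - i))
    simp only [Nat.add_sub_cancel] at h1 h2
    rw [ratioWeight, show p + q + 1 + 1 = (p + 1) + (q + 1) by ring, Finset.prod_range_add,
      mul_inv, ← Finset.prod_inv_distrib, ← Finset.prod_inv_distrib, ← h1, ← h2,
      ← Finset.prod_mul_distrib, ← Finset.prod_div_distrib]
    congr 1
    · refine Finset.prod_congr rfl fun j hj => ?_
      by_cases hji : j = i
      · simp [hji]
      · simp only [hji, if_false, inv_inv]
        rw [ratio_sub_ratio hm hi (Finset.mem_range.1 hj)]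
        simp only [n]
        push_cast
        ring_nf
    · rw [← hc, Finset.prod_congr rfl (g := fun _ => ratio (p + q + 1) (p + 1) i)]
      · simp
      · intro j _
        rw [if_neg (by omega), inv_inv, ratio_of_ge (i := p + 1 + j) (by omega), sub_zero]
  have hR := prod_range_ite_top_sub (n := n) (m := p + 1) (by omega) hi
  set R := ∏ j ∈ Finset.range (p + 1), (if j = i then (1 : ℝ) else (n : ℝ) - j)
  have hR0 : R ≠ 0 := by
    rintro h
    rw [h, zero_mul, zero_mul] at hR
    exact (Nat.cast_ne_zero.2 (Nat.factorial_ne_zero n)) hR.symm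
  rw [show n - (p + 1) = q + 1 by omega] at hR
  rw [← inv_inv (ratioWeight _ _ _), hW, hc, coeffA, coeffa]
  rw [show p + q + 1 + 1 - (p + 1) = q + 1 by omega, show p + q + 1 + 1 = n from rfl, ← hR]
  have e1 : (((p + q + 1 : ℕ) : ℝ) + 1 - ((p + 1 : ℕ) : ℝ)) = (q : ℝ) + 1 := by push_cast; ring
  have e2 : (((p + 1 : ℕ) : ℝ) + 1 - ((i + 1 : ℕ) : ℝ)) = (p : ℝ) + 1 - i := by push_cast; ring
  have e3 : (((p + 1 : ℕ) : ℤ) - 2) = (p : ℤ) - 1 := by push_cast; ring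
  rw [e1, e2, e3, zpow_sub_one₀ hM.ne', zpow_natCast, show p + 1 - (i + 1) = p - i by omega]
  simp only [Nat.add_sub_cancel]
  rw [show p + q = (q + 1) + p - 1 by omega]
  set M := (p : ℝ) + 1 - i
  set D := (n : ℝ) - i
  have hq : (q : ℝ) + 1 ≠ 0 := by positivity
  have hs : ((-1 : ℝ) ^ i) * (-1) ^ i = 1 := by rw [← mul_pow]; simp
  have hpow : (M / D) ^ (q + 1 + p - 1) = (M / D) ^ (q + 1) * (M / D) ^ p * (M / D)⁻¹ := by
    rw [← pow_add, show q + 1 + p - 1 = q + p by omega, show q + 1 + p = q + p + 1 by omega,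
      pow_succ, mul_inv_cancel_right₀ (by positivity)]
  rw [hpow]
  simp only [div_pow]
  have hD : D ≠ 0 := hiN.ne'
  have hM' : M ≠ 0 := hM.ne'
  field_simp
  rw [sq, hs]

/-! ### Laws of the small and large spacing sums. -/

theorem maxSum_eq_one_sub_minSum {N k : ℕ} (hk : k ≤ N + 1) (x : Fin N → ℝ) :
    maxSum k x = 1 - minSum (N + 1 - k) x := by
  rw [eq_sub_iff_add_eq, ← sum_spacing x, ← sum_sorted, maxSum, minSum, Finset.sum_filter,
    Finset.sum_filter, ← Equiv.sum_comp Fin.revPerm, ← Finset.sum_add_distrib]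
  refine Finset.sum_congr rfl fun j _ => ?_
  have hj := j.2
  simp only [Fin.revPerm_apply, Fin.rev_rev, Fin.val_rev]
  by_cases h : j.val < N + 1 - k
  · rw [if_neg (by omega), if_pos h, zero_add]
  · rw [if_pos (by omega), if_neg h, add_zero]

/-- Endpoints are null, so the cube can be taken open, as in `volume_spacing_mem`. -/
theorem map_eq_restrict_cube {Ω : Type*} [MeasurableSpace Ω] (P : Measure Ω)
    [IsProbabilityMeasure P] {N : ℕ} {X : Fin N → Ω → ℝ} (hX : ∀ i, Measurable (X i))
    (hindep : iIndepFun X P)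
    (hunif : ∀ i, pdf.IsUniform (X i) (Set.Icc (0 : ℝ) 1) P volume) :
    P.map (fun ω i => X i ω) =
      (volume : Measure (Fin N → ℝ)).restrict (Set.univ.pi fun _ => Set.Ioo 0 1) := by
  have h1 : ∀ i, P.map (X i) = (volume : Measure ℝ).restrict (Set.Ioo 0 1) := by
    intro i
    rw [hunif i, ProbabilityTheory.cond, Real.volume_Icc, restrict_Ioo_eq_restrict_Icc]
    simp
  rw [hindep.map_fun_eq_pi_map fun i => (hX i).aemeasurable, volume_pi, Measure.restrict_pi_pi]
  simp_rw [h1]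

/-- The scale of the `i`-th summand (counted from `1`) in the density of `minSum m`. -/
noncomputable def scale (N m i : ℕ) : ℝ := ((m : ℝ) + 1 - i) / ((N : ℝ) + 2 - i)

theorem scale_succ {N m i : ℕ} (hi : i < m) : scale N m (i + 1) = ratio N m i := by
  rw [scale, ratio, Nat.cast_sub hi.le]
  push_cast
  congr 1 <;> ring

theorem scale_pos {N m i : ℕ} (hm : m ≤ N) (hi : i ∈ Finset.Icc 1 m) : 0 < scale N m i := by
  obtain ⟨j, rfl⟩ : ∃ j, i = j + 1 := ⟨i - 1, by have := Finset.mem_Icc.1 hi; omega⟩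
  have := Finset.mem_Icc.1 hi
  rw [scale_succ (by omega)]
  exact ratio_pos hm (by omega)

theorem sum_Icc_one_eq_sum_range {m : ℕ} (f : ℕ → ℝ) :
    ∑ i ∈ Finset.Icc 1 m, f i = ∑ i ∈ Finset.range m, f (i + 1) := by
  rw [Finset.range_eq_Ico, Finset.sum_Ico_add' f 0 m 1]
  rfl

theorem expPi_real_ratio {N m : ℕ} (hN : 1 ≤ N) (hm : m ≤ N) {t : ℝ} (ht : 0 ≤ t) :
    (expPi (N + 1)).real {z | 0 < ∑ i : Fin (N + 1), (ratio N m i - t) * z i} =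
      ∑ i ∈ Finset.Icc 1 m, coeffA m N * coeffa i m * kernelTail N (scale N m i) t := by
  rw [expPi_real_lt_sum (b := fun i : Fin (N + 1) => ratio N m i - t)
    (fun i j hij => sub_le_sub_right (ratio_antitone hm hij) t) _ le_rfl,
    sum_Icc_one_eq_sum_range]
  · simp only [mixCoeff_ratio_sub, zero_div, neg_zero, Real.exp_zero, mul_one]
    rw [Fin.sum_univ_eq_sum_range (fun i => if 0 < ratio N m i - t then
      (ratio N m i - t) ^ N * ratioWeight N m i else 0) (N + 1)]
    rw [← Finset.sum_subset (Finset.range_subset_range.2 (hm.trans N.le_succ))]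
    · refine Finset.sum_congr rfl fun i hi => ?_
      have hi' := Finset.mem_range.1 hi
      have hc := ratio_pos hm hi'
      rw [scale_succ hi', coeffA_mul_coeffa hm hi', kernelTail]
      set c := ratio N m i
      have hNR : (N : ℝ) ≠ 0 := by positivity
      have hpow : c ^ (N - 1) * c = c ^ N := by rw [← pow_succ, Nat.sub_add_cancel hN]
      have heq : (c - t) ^ N = c ^ N * (1 - t / c) ^ N := by
        rw [← mul_pow, mul_sub, mul_one, mul_div_cancel₀ _ hc.ne']
      rcases lt_trichotomy t c with h | h | h
      · rw [if_pos (sub_pos.2 h), H_of_mem ⟨ht, h.le⟩, heq, ← hpow]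
        field_simp
      -- At t = c the strict condition drops the term while the closed interval in `H` keeps it; it
      -- vanishes because N ≥ 1.
      · rw [if_neg (by simp [h]), h, div_self hc.ne', sub_self, zero_pow (by omega)]
        simp
      · rw [if_neg (by linarith), H_of_notMem (fun h' => h.not_ge h'.2)]
        simp
    · intro i _ hi
      rw [ratio_of_ge (not_lt.1 (mt Finset.mem_range.2 hi)), if_neg (by linarith)]
  · intro i j hij hpos
    have hi : (i : ℕ) < m := by
      by_contra h
      have h' := ratio_of_ge (N := N) (not_lt.1 h)
      simp only [h'] at hpos
      linarith
    exact sub_lt_sub_right (ratio_lt hm hij hi) t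

theorem minSumPdf_eq_sum (N m : ℕ) (s : ℝ) :
    minSumPdf m N s =
      ∑ i ∈ Finset.Icc 1 m, coeffA m N * coeffa i m * kernelPdf N (scale N m i) s := by
  rw [minSumPdf, Finset.mul_sum]
  refine Finset.sum_congr rfl fun i _ => ?_
  rw [kernelPdf, scale, div_div_eq_mul_div, mul_comm s, mul_div_right_comm]
  ring

theorem H_one_sub {k N i : ℕ} (hi : i ∈ Finset.Icc 1 (N + 1 - k)) (hk : 1 ≤ k) (s : ℝ) :
    H s (k / ((N : ℝ) + 2 - i)) 1 = H (1 - s) 0 (scale N (N + 1 - k) i) := by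
  have h := Finset.mem_Icc.1 hi
  have hd : (0 : ℝ) < (N : ℝ) + 2 - i := by
    rw [sub_pos]; exact_mod_cast (by omega : i < N + 2)
  have hs : scale N (N + 1 - k) i = 1 - k / ((N : ℝ) + 2 - i) := by
    rw [scale, Nat.cast_sub (by omega)]
    push_cast
    field_simp
    ring
  have hmem : s ∈ Set.Icc (k / ((N : ℝ) + 2 - i)) 1 ↔
      1 - s ∈ Set.Icc 0 (scale N (N + 1 - k) i) := by
    rw [hs, Set.mem_Icc, Set.mem_Icc]
    constructor <;> rintro ⟨h1, h2⟩ <;> constructor <;> linarith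
  by_cases h' : s ∈ Set.Icc (k / ((N : ℝ) + 2 - i)) 1
  · rw [H_of_mem h', H_of_mem (hmem.1 h')]
  · rw [H_of_notMem h', H_of_notMem (mt hmem.2 h')]

theorem one_sub_one_sub_div_scale {k N i : ℕ} (hi : i ∈ Finset.Icc 1 (N + 1 - k)) (s : ℝ) :
    1 - (1 - s) / scale N (N + 1 - k) i =
      (s * ((N : ℝ) + 2 - i) - k) / ((N : ℝ) + 2 - k - i) := by
  have h := Finset.mem_Icc.1 hi
  have hd : (0 : ℝ) < (N : ℝ) + 2 - i := by
    rw [sub_pos]; exact_mod_cast (by omega : i < N + 2)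
  have hd' : (0 : ℝ) < (N : ℝ) + 2 - k - i := by
    rw [sub_sub, sub_pos]; exact_mod_cast (by omega : k + i < N + 2)
  have hs : scale N (N + 1 - k) i = ((N : ℝ) + 2 - k - i) / ((N : ℝ) + 2 - i) := by
    rw [scale, Nat.cast_sub (by omega)]
    push_cast
    congr 1
    ring
  rw [hs, div_div_eq_mul_div, eq_div_iff hd'.ne', sub_mul, div_mul_cancel₀ _ hd'.ne']
  ring

theorem maxSumPdf_eq_minSumPdf {k N : ℕ} (hk : 1 ≤ k) (s : ℝ) :
    maxSumPdf k N s = minSumPdf (N + 1 - k) N (1 - s) := by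
  rw [minSumPdf_eq_sum, maxSumPdf, Finset.mul_sum]
  refine Finset.sum_congr rfl fun i hi => ?_
  rw [kernelPdf, one_sub_one_sub_div_scale hi, H_one_sub hi hk]
  ring

theorem maxSumCdf_eq_sum {k N : ℕ} (hk : 1 ≤ k) (hkN : k ≤ N) (s : ℝ) :
    maxSumCdf k N s = ∑ i ∈ Finset.Icc 1 (N + 1 - k), coeffA (N + 1 - k) N *
      coeffa i (N + 1 - k) * kernelTail N (scale N (N + 1 - k) i) (1 - s) := by
  rw [maxSumCdf, Finset.mul_sum]
  refine Finset.sum_congr rfl fun i hi => ?_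
  rw [kernelTail, one_sub_one_sub_div_scale hi, H_one_sub hi hk, scale, Nat.cast_sub (by omega)]
  push_cast
  ring

theorem HasDensity.one_sub {Ω : Type*} [MeasurableSpace Ω] {P : Measure Ω} {Y : Ω → ℝ}
    {f : ℝ → ℝ} (h : HasDensity P Y f) :
    HasDensity P (fun ω => 1 - Y ω) fun s => f (1 - s) := by
  obtain ⟨h1, h2, h3, h4⟩ := h
  have hg : Measurable fun x : ℝ => 1 - x := by fun_prop
  refine ⟨hg.comp_aemeasurable h1, h2.comp hg, fun s => h3 _, ?_⟩
  have h5 : P.map (fun ω => 1 - Y ω) = (P.map Y).map (fun x => 1 - x) :=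
    (AEMeasurable.map_map_of_aemeasurable hg.aemeasurable h1).symm
  rw [h5, h4]
  ext A hA
  have h6 := (volume.measurePreserving_sub_left (1 : ℝ)).setLIntegral_comp_preimage hA
    (f := fun s => ENNReal.ofReal (f (1 - s))) (h2.comp hg).ennreal_ofReal
  rw [Measure.map_apply hg hA, withDensity_apply _ (hg hA), withDensity_apply _ hA, ← h6]
  simp

/-- The law of the sum of the `m` smallest spacings of a uniform sample. -/
theorem minSum_law {Ω : Type*} [MeasurableSpace Ω] (P : Measure Ω) [IsProbabilityMeasure P]
    {N : ℕ} {X : Fin N → Ω → ℝ} (hX : ∀ i, Measurable (X i)) (hindep : iIndepFun X P)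
    (hunif : ∀ i, pdf.IsUniform (X i) (Set.Icc (0 : ℝ) 1) P volume)
    {m : ℕ} (hm0 : 1 ≤ m) (hm : m ≤ N) :
    HasDensity P (fun ω => minSum m (fun i => X i ω)) (minSumPdf m N) ∧
      ∀ t, 0 ≤ t → P.real {ω | t < minSum m (fun i => X i ω)} =
        ∑ i ∈ Finset.Icc 1 m, coeffA m N * coeffa i m * kernelTail N (scale N m i) t := by
  have hXm : Measurable fun ω i => X i ω := measurable_pi_iff.2 hX
  have hYm : Measurable fun ω => minSum m (fun i => X i ω) := (measurable_minSum m).comp hXm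
  have hN : 1 ≤ N := hm0.trans hm
  have hP : ∀ t, P.real {ω | t < minSum m (fun i => X i ω)} =
      (expPi (N + 1)).real {z | 0 < ∑ i : Fin (N + 1), (ratio N m i - t) * z i} := by
    intro t
    have hS : MeasurableSet {x : Fin N → ℝ | t < minSum m x} :=
      measurableSet_lt measurable_const (measurable_minSum m)
    rw [measureReal_def, measureReal_def, ← volume_lt_minSum hm]
    congr 1
    change P ((fun ω i => X i ω) ⁻¹' {x : Fin N → ℝ | t < minSum m x}) = _
    rw [← Measure.map_apply hXm hS, map_eq_restrict_cube P hX hindep hunif,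
      Measure.restrict_apply hS]
    congr 1
    ext x
    simp [and_comm, Set.mem_pi]
  have htail : ∀ t, 0 ≤ t → P.real {ω | t < minSum m (fun i => X i ω)} =
      ∑ i ∈ Finset.Icc 1 m, coeffA m N * coeffa i m * kernelTail N (scale N m i) t :=
    fun t ht => (hP t).trans (expPi_real_ratio hN hm ht)
  refine ⟨?_, htail⟩
  have : IsProbabilityMeasure (P.map fun ω => minSum m (fun i => X i ω)) :=
    Measure.isProbabilityMeasure_map hYm.aemeasurable
  have hmap : ∀ t, (P.map fun ω => minSum m (fun i => X i ω)).real (Set.Ioi t) =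
      P.real {ω | t < minSum m (fun i => X i ω)} := fun t =>
    map_measureReal_apply hYm measurableSet_Ioi
  -- At t = 0 all coefficients are nonnegative and the first is positive, so there is no mass on the
  -- nonpositive half-line.
  have h0 : P.real {ω | 0 < minSum m (fun i => X i ω)} = 1 := by
    rw [hP]
    simp only [sub_zero]
    exact expPi_real_zero_lt_sum (fun i => ratio_nonneg hm i) ⟨0, ratio_pos hm hm0⟩
  obtain ⟨h1, h2⟩ := eq_withDensity_of_tail hN (fun i hi => scale_pos hm hi)
    (P.map fun ω => minSum m (fun i => X i ω))
    (fun t ht => (hmap t).trans (htail t ht)) ((hmap 0).trans h0)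
  have hpdf : minSumPdf m N = fun s =>
      ∑ i ∈ Finset.Icc 1 m, coeffA m N * coeffa i m * kernelPdf N (scale N m i) s :=
    funext (minSumPdf_eq_sum N m)
  rw [hpdf]
  exact ⟨hYm.aemeasurable, Finset.measurable_sum _ fun i _ =>
    (measurable_kernelPdf N _).const_mul _, h1, h2⟩

end OrderedSpacings

theorem mainTheorem2 {Ω : Type*} [MeasurableSpace Ω] (P : Measure Ω) [IsProbabilityMeasure P]
    (N : ℕ) (X : Fin N → Ω → ℝ) (hX : ∀ i, Measurable (X i)) (hindep : iIndepFun X P)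
    (hunif : ∀ i, pdf.IsUniform (X i) (Set.Icc (0 : ℝ) 1) P volume) :
    (∀ k ≤ N + 1, ∀ ω, OrderedSpacings.maxSum k (fun i => X i ω) =
        1 - OrderedSpacings.minSum (N + 1 - k) (fun i => X i ω)) ∧
    ∀ k, 1 ≤ k → k ≤ N →
      OrderedSpacings.HasDensity P (fun ω => OrderedSpacings.minSum (N + 1 - k) (fun i => X i ω))
        (OrderedSpacings.minSumPdf (N + 1 - k) N) ∧
      (∀ s, OrderedSpacings.maxSumPdf k N s = OrderedSpacings.minSumPdf (N + 1 - k) N (1 - s)) ∧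
      OrderedSpacings.HasDensity P (fun ω => OrderedSpacings.maxSum k (fun i => X i ω))
        (OrderedSpacings.maxSumPdf k N) ∧
      ∀ s ≤ 1,
        P.real {ω | OrderedSpacings.maxSum k (fun i => X i ω) ≤ s} =
          OrderedSpacings.maxSumCdf k N s ∧
        P.real {ω | s ≤ OrderedSpacings.maxSum k (fun i => X i ω)} =
          1 - OrderedSpacings.maxSumCdf k N s := by
  refine ⟨fun k hk ω => OrderedSpacings.maxSum_eq_one_sub_minSum hk _, fun k hk hkN => ?_⟩
  have hm0 : 1 ≤ N + 1 - k := by omega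
  have hm : N + 1 - k ≤ N := by omega
  obtain ⟨hdens, htail⟩ := OrderedSpacings.minSum_law P hX hindep hunif hm0 hm
  have hpdf := fun s => OrderedSpacings.maxSumPdf_eq_minSumPdf (N := N) hk s
  have hmax : ∀ ω, OrderedSpacings.maxSum k (fun i => X i ω) =
      1 - OrderedSpacings.minSum (N + 1 - k) (fun i => X i ω) :=
    fun ω => OrderedSpacings.maxSum_eq_one_sub_minSum (by omega) _
  refine ⟨hdens, hpdf, ?_, fun s hs => ?_⟩
  · rw [funext hpdf]
    simp_rw [hmax]
    exact hdens.one_sub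
  · have hYm : Measurable fun ω => OrderedSpacings.minSum (N + 1 - k) (fun i => X i ω) :=
      (OrderedSpacings.measurable_minSum _).comp (measurable_pi_iff.2 hX)
    -- Having a density excludes atoms; this reconciles S_k ≤ s, that is s_m ≥ 1 - s, with the
    -- strict tail of s_m.
    have hnull : P {ω | OrderedSpacings.minSum (N + 1 - k) (fun i => X i ω) = 1 - s} = 0 := by
      have h1 := Measure.map_apply (μ := P) hYm (measurableSet_singleton (1 - s))
      rw [hdens.2.2.2] at h1
      have h2 : ((volume : Measure ℝ).withDensity fun s => ENNReal.ofReal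
          (OrderedSpacings.minSumPdf (N + 1 - k) N s)) {1 - s} = 0 :=
        withDensity_absolutelyContinuous _ _ (measure_singleton _)
      exact h1.symm.trans h2
    have hcdf : P.real {ω | 1 - s < OrderedSpacings.minSum (N + 1 - k) (fun i => X i ω)} =
        OrderedSpacings.maxSumCdf k N s := by
      rw [OrderedSpacings.maxSumCdf_eq_sum hk hkN, htail _ (sub_nonneg.2 hs)]
    constructor
    · rw [← hcdf]
      refine measureReal_congr ?_
      have h : ∀ᵐ ω ∂P, OrderedSpacings.minSum (N + 1 - k) (fun i => X i ω) ≠ 1 - s := by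
        rw [ae_iff]; simpa using hnull
      filter_upwards [h] with ω hω
      refine propext ?_
      change OrderedSpacings.maxSum k (fun i => X i ω) ≤ s ↔
        1 - s < OrderedSpacings.minSum (N + 1 - k) (fun i => X i ω)
      rw [hmax]
      exact ⟨fun h => lt_of_le_of_ne (by linarith) hω.symm, fun h => by linarith⟩
    · rw [← hcdf, ← probReal_compl_eq_one_sub (measurableSet_lt measurable_const hYm)]
      congr 1
      ext ω
      simp only [Set.mem_ofPred_eq, Set.mem_compl_iff, hmax, not_lt]
      constructor <;> intro h <;> linarith
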